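/- For every $\epsilon>0$ there is $\delta=\delta(\epsilon)>0$ such that the following holds. Let $q=p^\ell$ be an odd prime power and let $\varphi:\mathbb{Z}_{\ge 0}\to\mathbb{R}$ satisfy $\varphi(r)=o(r)$ as $r\to\infty$. Then there is a constant $C>0$, depending only on $\epsilon$, on the fixed field $\mathbb{F}_q$ and on $\varphi$, such that for every $F\in\mathbb{F}_q[T]$ of degree $r$ (arbitrary, not necessarily irreducible or square-free), every $a\in\mathbb{F}_q[T]$ coprime to $F$, all positive integers $m,n$ with $$n\ge r\epsilon\quad\text{and}\quad m\ge r\left(\tfrac14+\epsilon\right),$$ and all complex weights $\alpha=(\alpha_{x_1})_{\deg x_1<m}$, $\beta=(\beta_{x_2})_{\deg x_2<n}$ with $\|\alpha\|_\infty,\|\beta\|_\infty\le q^{\varphi(r)}$, one has $$\Bigl|\sum_{\substack{\deg x_1<m\\(x_1,F)=1}}\ \sum_{\substack{\deg x_2<n\\(x_2,F)=1}}\alpha_{x_1}\beta_{x_2}\,e_F(a\,\overline{x_1x_2})\Bigr|\le C\,q^{m+n-r\delta}.$$ Here $\overline{x}$ is the inverse of $x$ modulo $F$, and $e_F(x)=e(x/F)$,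 where on Laurent series in $1/T$ over $\mathbb{F}_q$ we put $e\bigl(\sum_{i\le N}a_iT^i\bigr)=\exp\bigl(\tfrac{2\pi i}{p}\mathrm{Tr}(a_{-1})\bigr)$ with $\mathrm{Tr}:\mathbb{F}_q\to\mathbb{F}_p$ the absolute trace; the zero polynomial counts as having degree less than every integer. -/

import Mathlib

open Polynomial

namespace FqKloosterman

noncomputable section

/-- The embedding of `K[T]` into the field of Laurent series in `1/T` over `K`.  A Laurent series
in `1/T` is written as an element of `LaurentSeries K` in the uniformizer `1/T`, so that
`coeff i` is the coefficient of `T ^ (-i)`; in particular `T` is sent to `single (-1) 1`. -/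
def toInfty (K : Type*) [Field K] : K[X] →+* LaurentSeries K :=
  Polynomial.eval₂RingHom HahnSeries.C (HahnSeries.single (-1 : ℤ) (1 : K))

/-- The absolute trace of the field `K` down to its prime field, for `K` of positive
characteristic. -/
def absTrace (K : Type*) [Field K] (c : K) : ZMod (ringChar K) :=
  letI : Algebra (ZMod (ringChar K)) K := ZMod.algebra K (ringChar K)
  Algebra.trace (ZMod (ringChar K)) K c

/-- The additive character `e(∑ a_i T^i) = exp (2 π i Tr (a_{-1}) / p)` on Laurent series
in `1/T`, where `p` is the characteristic of `K`. -/
def eInfty {K : Type*} [Field K] (z : LaurentSeries K) : ℂ :=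
  Complex.exp (2 * Real.pi * Complex.I / (ringChar K : ℂ) * ((absTrace K (z.coeff 1)).val : ℂ))

/-- `e_F(x) = e(x / F)`, the quotient being taken in the field of Laurent series in `1/T`. -/
def eMod {K : Type*} [Field K] (F x : K[X]) : ℂ :=
  eInfty (toInfty K x / toInfty K F)

open Classical in
/-- The inverse of `x` modulo `F`, reduced modulo `F` (and `0` if `x` is not invertible). -/
def invMod {K : Type*} [Field K] (F x : K[X]) : K[X] :=
  if h : ∃ y : K[X], F ∣ x * y - 1 then h.choose % F else 0

theorem finite_degree_lt (K : Type*) [Field K] [Finite K] (n : ℕ) :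
    {x : K[X] | x.degree < (n : WithBot ℕ)}.Finite := by
  have : Finite (Polynomial.degreeLT K n) :=
    Finite.of_equiv _ (Polynomial.degreeLTEquiv K n).symm.toEquiv
  refine (Set.toFinite (Polynomial.degreeLT K n : Set K[X])).subset ?_
  intro x hx
  exact Polynomial.mem_degreeLT.2 hx

open Classical in
/-- The polynomials `x` with `deg x < n` and `(x, F) = 1` (where `deg 0 = ⊥`). -/
def coprimeLT {K : Type*} [Field K] [Finite K] (F : K[X]) (n : ℕ) : Finset K[X] :=
  (finite_degree_lt K n).toFinset.filter (fun x => IsCoprime x F)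

/-- The bilinear Kloosterman sum `W_{F,a}(m, n; α, β)`. -/
def bilinearSum {K : Type*} [Field K] [Finite K] (F a : K[X]) (m n : ℕ) (α β : K[X] → ℂ) : ℂ :=
  ∑ x₁ ∈ coprimeLT F m, ∑ x₂ ∈ coprimeLT F n, α x₁ * β x₂ * eMod F (a * invMod F (x₁ * x₂))

end

end FqKloosterman

/-! Let q be the size of the field, r = deg F, and let E_k(n) count the solutions of 1/x₁ + … +
1/x_k ≡ 1/y₁ + … + 1/y_k mod F with all entries coprime to F of degree < n. Hölder's inequality and
Parseval on K[T]/F give |W|^(4k) ≤ q^(4m(k-1)) q^(2kn) E_k(n) q^r E_2(m) for weights bounded by 1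
(`norm_bilinear_pow_le`). It remains to save q^(r/2) in E_k(n) against q^(2kn), up to
divisor-function losses, and slightly more than q^(r/2) in E_2(m) against q^(4m).

For E_k (`energy_inv_le`), clearing denominators turns the congruence into polynomial equations with
right-hand side F c. There are about max(1, q^((2k-1)n-r)) values of c, and each equation has about
q^(kn) solutions: for c = 0 the product of all entries is squarefull, for c ≠ 0 one tuple fixes a
residue class for the product of the other. The choice k = ⌈r/(2n)⌉ makes this sufficient.

For E_2 (`energy_two_inv_le`), Dirichlet approximation u ≡ vλ turns 1/x + 1/y ≡ λ into u x y ≡ v(x +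
y), and each lift of this to K[T] factors as (u x - v)(u y - v) = v² + u F t. This gives about q^(2m
+ max(0, (3m-r)/2)). For small m the diagonal q^(2m) dominates, and it beats q^(4m-r/2) exactly when
m > r/4. As F is arbitrary, u may vanish; then x + y has a large divisor in common with F, which is
rare. -/

namespace FqKloosterman

/-! ### The additive character modulo F and its primitivity -/

section Character

variable {K : Type*} [Field K]

theorem toInfty_monomial (n : ℕ) (a : K) :
    toInfty K (monomial n a) = HahnSeries.single (-(n : ℤ)) a := by
  simp [toInfty, HahnSeries.single_pow, HahnSeries.C_apply, HahnSeries.single_mul_single]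

theorem coeff_toInfty (x : K[X]) (i : ℤ) :
    (toInfty K x).coeff i = if i ≤ 0 then x.coeff (-i).toNat else 0 := by
  induction x using Polynomial.induction_on' with
  | add p q hp hq =>
    rw [map_add, HahnSeries.coeff_add, hp, hq]
    split_ifs <;> simp
  | monomial n a =>
    rw [toInfty_monomial, HahnSeries.coeff_single, coeff_monomial]
    by_cases hi : i = -(n : ℤ)
    · subst hi; simp
    · rw [if_neg hi]
      split_ifs with h1 h2
      · exfalso; omega
      · rfl
      · rfl

theorem toInfty_ne_zero {x : K[X]} (hx : x ≠ 0) : toInfty K x ≠ 0 := by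
  intro h
  have h1 := coeff_toInfty x (-(x.natDegree : ℤ))
  rw [h] at h1
  simp only [HahnSeries.coeff_zero] at h1
  exact hx (by simpa using h1.symm)

theorem order_toInfty {x : K[X]} (hx : x ≠ 0) :
    (toInfty K x).order = -(x.natDegree : ℤ) := by
  apply le_antisymm
  · apply HahnSeries.order_le_of_coeff_ne_zero
    rw [coeff_toInfty]
    simpa using hx
  · by_contra! h
    have h1 := (HahnSeries.coeff_order_eq_zero (x := toInfty K x)).not.2 (toInfty_ne_zero hx)
    rw [coeff_toInfty, if_pos (by omega), coeff_eq_zero_of_natDegree_lt (by omega)] at h1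
    exact h1 rfl

theorem absTrace_add (a b : K) : absTrace K (a + b) = absTrace K a + absTrace K b := by
  simp [absTrace]

theorem eInfty_eq_stdAddChar [NeZero (ringChar K)] (z : LaurentSeries K) :
    eInfty z = ZMod.stdAddChar (absTrace K (z.coeff 1)) := by
  rw [ZMod.stdAddChar_apply, ZMod.toCircle_apply, eInfty]
  congr 1
  ring

variable [Finite K]

instance neZero_ringChar : NeZero (ringChar K) :=
  ⟨CharP.char_ne_zero_of_finite K (ringChar K)⟩

theorem eMod_add (F x y : K[X]) : eMod F (x + y) = eMod F x * eMod F y := by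
  simp only [eMod, eInfty_eq_stdAddChar]
  rw [map_add, add_div, HahnSeries.coeff_add, absTrace_add, AddChar.map_add_eq_mul]

theorem eMod_mul_self {F : K[X]} (hF : F ≠ 0) (x : K[X]) : eMod F (F * x) = 1 := by
  simp only [eMod, eInfty_eq_stdAddChar]
  rw [map_mul, mul_div_cancel_left₀ _ (toInfty_ne_zero hF), coeff_toInfty]
  simp [absTrace]

theorem eMod_congr {F : K[X]} (hF : F ≠ 0) {x y : K[X]} (h : F ∣ x - y) :
    eMod F x = eMod F y := by
  obtain ⟨z, hz⟩ := h
  rw [← sub_add_cancel x y, eMod_add, hz, eMod_mul_self hF, one_mul]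

/-- Multiplying the residue of `μ` by a power of `X` raises its degree to deg F - 1, so its quotient
by `F` has a nonzero coefficient at 1/T. Nondegeneracy of the trace supplies a scalar that makes the
trace of this coefficient nonzero. -/
theorem exists_eMod_ne_one {F μ : K[X]} (hF : F ≠ 0) (hμ : ¬ F ∣ μ) :
    ∃ x : K[X], eMod F (μ * x) ≠ 1 := by
  set w := μ % F with hw
  have hw0 : w ≠ 0 := fun h => hμ (EuclideanDomain.mod_eq_zero.1 h)
  have hdeg : w.natDegree < F.natDegree := by
    have h1 : w.degree < F.degree := EuclideanDomain.mod_lt μ hF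
    exact natDegree_lt_natDegree hw0 h1
  set k := F.natDegree - 1 - w.natDegree with hk
  have hwk : w * X ^ k ≠ 0 := mul_ne_zero hw0 (pow_ne_zero _ X_ne_zero)
  set z := toInfty K (w * X ^ k) / toInfty K F with hz
  have hz0 : z ≠ 0 := div_ne_zero (toInfty_ne_zero hwk) (toInfty_ne_zero hF)
  have hzo : z.order = 1 := by
    have h1 : z * toInfty K F = toInfty K (w * X ^ k) :=
      div_mul_cancel₀ _ (toInfty_ne_zero hF)
    have h2 := HahnSeries.order_mul hz0 (toInfty_ne_zero hF)
    rw [h1, order_toInfty hwk, order_toInfty hF, natDegree_mul_X_pow _ hw0] at h2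
    omega
  have hc : z.coeff 1 ≠ 0 := by
    have := (HahnSeries.coeff_order_eq_zero (x := z)).not.2 hz0
    rwa [hzo] at this
  let _ : Algebra (ZMod (ringChar K)) K := ZMod.algebra K (ringChar K)
  obtain ⟨b, hb⟩ := FiniteField.trace_to_zmod_nondegenerate K hc
  refine ⟨X ^ k * C b, ?_⟩
  have h3 : eMod F (μ * (X ^ k * C b)) = eMod F (w * X ^ k * C b) := by
    apply eMod_congr hF
    refine ⟨μ / F * X ^ k * C b, ?_⟩
    have h4 : F * (μ / F) + w = μ := EuclideanDomain.div_add_mod μ F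
    linear_combination (-(X ^ k * C b)) * h4
  rw [h3]
  simp only [eMod, eInfty_eq_stdAddChar]
  rw [map_mul, mul_div_right_comm, ← hz]
  have h5 : toInfty K (C b) = HahnSeries.C b := by simp [toInfty]
  rw [h5, mul_comm, HahnSeries.C_mul_eq_smul, HahnSeries.coeff_smul]
  intro h6
  apply hb
  have h7 := ZMod.injective_stdAddChar (h6.trans (AddChar.map_zero_eq_one _).symm)
  rw [mul_comm]
  exact h7

/-- The additive character of `K[T] / F` induced by `eMod F`. -/
noncomputable def quotChar {F : K[X]} (hF : F ≠ 0) : AddChar (AdjoinRoot F) ℂ where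
  toFun z := eMod F (Function.surjInv (AdjoinRoot.mk_surjective (g := F)) z)
  map_zero_eq_one' := by
    have h : F ∣ Function.surjInv (AdjoinRoot.mk_surjective (g := F)) 0 - 0 := by
      rw [← AdjoinRoot.mk_eq_mk, Function.surjInv_eq AdjoinRoot.mk_surjective, map_zero]
    rw [eMod_congr hF h]
    simpa using eMod_mul_self hF 0
  map_add_eq_mul' a b := by
    rw [← eMod_add]
    apply eMod_congr hF
    rw [← AdjoinRoot.mk_eq_mk, map_add]
    simp only [Function.surjInv_eq AdjoinRoot.mk_surjective]

theorem quotChar_mk {F : K[X]} (hF : F ≠ 0) (x : K[X]) :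
    quotChar hF (AdjoinRoot.mk F x) = eMod F x := by
  apply eMod_congr hF
  rw [← AdjoinRoot.mk_eq_mk, Function.surjInv_eq AdjoinRoot.mk_surjective]

theorem quotChar_isPrimitive {F : K[X]} (hF : F ≠ 0) : (quotChar hF).IsPrimitive := by
  intro a ha h
  obtain ⟨μ, rfl⟩ := AdjoinRoot.mk_surjective a
  obtain ⟨x, hx⟩ := exists_eMod_ne_one hF (fun h => ha (AdjoinRoot.mk_eq_zero.2 h))
  apply hx
  have h1 := DFunLike.congr_fun h (AdjoinRoot.mk F x)
  rwa [AddChar.mulShift_apply, ← map_mul, quotChar_mk, AddChar.one_apply] at h1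

theorem finite_adjoinRoot {F : K[X]} (hF : F ≠ 0) : Finite (AdjoinRoot F) := by
  have := (AdjoinRoot.powerBasis hF).finite
  exact Module.finite_of_finite K

end Character

/-! ### Size and inverses in K[T]/F -/

section Quotient

variable {K : Type*} [Field K]

theorem natCard_adjoinRoot {F : K[X]} (hF : F ≠ 0) :
    Nat.card (AdjoinRoot F) = Nat.card K ^ F.natDegree := by
  have := (AdjoinRoot.powerBasis hF).finite
  rw [Module.natCard_eq_pow_finrank (K := K), (AdjoinRoot.powerBasis hF).finrank,
    AdjoinRoot.powerBasis_dim]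

theorem mk_mul_mk_invMod {F x : K[X]} (hx : IsCoprime x F) :
    AdjoinRoot.mk F x * AdjoinRoot.mk F (invMod F x) = 1 := by
  have h : ∃ y : K[X], F ∣ x * y - 1 := by
    obtain ⟨a, b, hab⟩ := hx
    exact ⟨a, -b, by linear_combination hab⟩
  rw [invMod, dif_pos h, ← map_mul, ← map_one (AdjoinRoot.mk F), AdjoinRoot.mk_eq_mk]
  obtain ⟨z, hz⟩ := h.choose_spec
  have h4 : F * (h.choose / F) + h.choose % F = h.choose :=
    EuclideanDomain.div_add_mod _ F
  exact ⟨z - x * (h.choose / F), by linear_combination hz + x * h4⟩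

theorem mk_invMod_mul {F x y : K[X]} (hx : IsCoprime x F) (hy : IsCoprime y F) :
    AdjoinRoot.mk F (invMod F (x * y)) =
      AdjoinRoot.mk F (invMod F x) * AdjoinRoot.mk F (invMod F y) := by
  have h1 := mk_mul_mk_invMod hx
  have h2 := mk_mul_mk_invMod hy
  have h3 := mk_mul_mk_invMod (hx.mul_left hy)
  rw [map_mul] at h3
  linear_combination (-AdjoinRoot.mk F (invMod F (x * y))) * (AdjoinRoot.mk F y *
    AdjoinRoot.mk F (invMod F y)) * h1 - AdjoinRoot.mk F (invMod F (x * y)) * h2 +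
    AdjoinRoot.mk F (invMod F x) * AdjoinRoot.mk F (invMod F y) * h3

end Quotient

/-! ### Bilinear character sums bounded by additive energies -/

section Bilinear

open Finset

variable {R : Type*} [CommRing R]

open Classical in
/-- The number of representations of `y` as a sum of `k` values of `u` on `A`. -/
noncomputable def repCount {ι : Type*} (A : Finset ι) (u : ι → R) (k : ℕ) (y : R) : ℕ :=
  #{s ∈ Fintype.piFinset (fun _ : Fin k => A) | ∑ i, u (s i) = y}

open Classical in
/-- The additive energy of order `k` of the family `u` on `A`. -/
noncomputable def energy {ι : Type*} (A : Finset ι) (u : ι → R) (k : ℕ) : ℕ :=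
  #{p ∈ Fintype.piFinset (fun _ : Fin k => A) ×ˢ Fintype.piFinset (fun _ : Fin k => A) |
    ∑ i, u (p.1 i) = ∑ i, u (p.2 i)}

theorem sum_repCount [Fintype R] {ι : Type*} (A : Finset ι) (u : ι → R) (k : ℕ) :
    ∑ y, repCount A u k y = #A ^ k := by
  classical
  unfold repCount
  rw [← card_eq_sum_card_fiberwise (f := fun s : Fin k → ι => ∑ i, u (s i))
    (fun _ _ => mem_coe.2 (mem_univ _)), Fintype.card_piFinset]
  simp

theorem sum_repCount_sq [Fintype R] {ι : Type*} (A : Finset ι) (u : ι → R) (k : ℕ) :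
    ∑ y, repCount A u k y ^ 2 = energy A u k := by
  classical
  unfold repCount energy
  rw [card_eq_sum_card_fiberwise (f := fun p => ∑ i, u (p.2 i)) (t := univ)
    (fun _ _ => mem_coe.2 (mem_univ _))]
  refine sum_congr rfl fun y _ => ?_
  rw [sq, ← card_product]
  congr 1
  ext p
  simp only [mem_product, mem_filter]
  constructor
  · rintro ⟨⟨h1, h2⟩, h3, h4⟩
    exact ⟨⟨⟨h1, h3⟩, h2.trans h4.symm⟩, h4⟩
  · rintro ⟨⟨⟨h1, h3⟩, h2⟩, h4⟩
    exact ⟨⟨h1, h2.trans h4⟩, h3, h4⟩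

/-- This makes the final bound independent of the unit `a` in the phase. -/
theorem energy_mul_left {ι : Type*} (A : Finset ι) (u : ι → R) (k : ℕ) {c : R} (hc : IsUnit c) :
    energy A (fun x => c * u x) k = energy A u k := by
  unfold energy
  congr 1
  ext p
  simp only [mem_filter, ← mul_sum, hc.mul_right_inj]

/-- Parseval: once the square is opened, the sum over `y` vanishes off the diagonal by primitivity.
-/
theorem sum_norm_sq_charSum [Fintype R] {ψ : AddChar R ℂ} (hψ : ψ.IsPrimitive) (c : R → ℂ) :
    ∑ y, ‖∑ z, c z * ψ (z * y)‖ ^ 2 = Fintype.card R * ∑ z, ‖c z‖ ^ 2 := by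
  classical
  have key : ∀ y, (∑ z, c z * ψ (z * y)) * (starRingEnd ℂ) (∑ z, c z * ψ (z * y)) =
      ∑ z, ∑ w, c z * (starRingEnd ℂ) (c w) * ψ (y * (z - w)) := by
    intro y
    rw [map_sum, sum_mul_sum]
    refine sum_congr rfl fun z _ => sum_congr rfl fun w _ => ?_
    rw [map_mul (starRingEnd ℂ), ← AddChar.map_neg_eq_conj]
    rw [show y * (z - w) = z * y + -(w * y) by ring, AddChar.map_add_eq_mul]
    ring
  have h : ((∑ y, ‖∑ z, c z * ψ (z * y)‖ ^ 2 : ℝ) : ℂ) =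
      ((Fintype.card R * ∑ z, ‖c z‖ ^ 2 : ℝ) : ℂ) := by
    push_cast
    simp only [← Complex.mul_conj']
    simp only [key]
    rw [sum_comm, mul_sum]
    refine sum_congr rfl fun z _ => ?_
    rw [sum_comm]
    simp only [← mul_sum, AddChar.sum_mulShift _ hψ, sub_eq_zero]
    simp
    ring
  exact_mod_cast h

theorem addChar_sum {ι : Type*} (ψ : AddChar R ℂ) (s : Finset ι) (f : ι → R) :
    ψ (∑ i ∈ s, f i) = ∏ i ∈ s, ψ (f i) := by
  classical
  induction s using Finset.induction_on with
  | empty => simp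
  | insert a s ha ih => rw [sum_insert ha, prod_insert ha, AddChar.map_add_eq_mul, ih]

theorem pow_charSum [Fintype R] {ι : Type*} (ψ : AddChar R ℂ) (A : Finset ι) (u : ι → R)
    (θ : ι → ℂ) (k : ℕ) (y : R) :
    (∑ i ∈ A, θ i * ψ (u i * y)) ^ k =
      ∑ s ∈ Fintype.piFinset (fun _ : Fin k => A), (∏ j, θ (s j)) * ψ ((∑ j, u (s j)) * y) := by
  have h := sum_pow' A (fun i => θ i * ψ (u i * y)) k
  rw [h]
  refine sum_congr rfl fun s _ => ?_
  rw [prod_mul_distrib, sum_mul, addChar_sum]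

/-- The `k`-th power of the sum is again a character sum, with coefficients dominated by `repCount`;
Parseval then produces the energy. -/
theorem sum_norm_charSum_pow_le [Fintype R] {ι : Type*} {ψ : AddChar R ℂ} (hψ : ψ.IsPrimitive)
    (A : Finset ι) (u : ι → R) (θ : ι → ℂ) (hθ : ∀ i ∈ A, ‖θ i‖ ≤ 1) (k : ℕ) :
    ∑ y, ‖∑ i ∈ A, θ i * ψ (u i * y)‖ ^ (2 * k) ≤ Fintype.card R * energy A u k := by
  classical
  let c : R → ℂ := fun z =>
    ∑ s ∈ Fintype.piFinset (fun _ : Fin k => A) with ∑ j, u (s j) = z, ∏ j, θ (s j)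
  have h1 : ∀ y, (∑ i ∈ A, θ i * ψ (u i * y)) ^ k = ∑ z, c z * ψ (z * y) := by
    intro y
    rw [pow_charSum, ← sum_fiberwise _ (fun s => ∑ j, u (s j))]
    refine sum_congr rfl fun z _ => ?_
    rw [sum_mul]
    refine sum_congr rfl fun s hs => ?_
    rw [(mem_filter.1 hs).2]
  have h2 : ∀ z, ‖c z‖ ≤ repCount A u k z := by
    intro z
    refine (norm_sum_le _ _).trans ?_
    unfold repCount
    rw [card_eq_sum_ones, Nat.cast_sum]
    refine sum_le_sum fun s hs => ?_
    rw [norm_prod, Nat.cast_one]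
    refine prod_le_one (fun _ _ => norm_nonneg _) fun j _ => hθ _ ?_
    exact Fintype.mem_piFinset.1 (mem_filter.1 hs).1 j
  calc ∑ y, ‖∑ i ∈ A, θ i * ψ (u i * y)‖ ^ (2 * k)
      = ∑ y, ‖∑ z, c z * ψ (z * y)‖ ^ 2 := by
        refine sum_congr rfl fun y _ => ?_
        rw [← h1, norm_pow, ← pow_mul, mul_comm]
    _ = Fintype.card R * ∑ z, ‖c z‖ ^ 2 := sum_norm_sq_charSum hψ c
    _ ≤ Fintype.card R * energy A u k := by
        rw [← sum_repCount_sq]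
        push_cast
        gcongr with z
        exact h2 z

/-- Hölder in `i` isolates the powers of the inner sums `S i`. A phase `θ i` replaces the norm of `S
i ^ (l + 1)` by the power itself, which can be expanded; the tuples from `B` then matter only
through their sum `y`. -/
theorem norm_bilinear_pow_le_sum [Fintype R] {ι κ : Type*} (ψ : AddChar R ℂ)
    (A : Finset ι) (B : Finset κ) (u : ι → R) (v : κ → R) (α : ι → ℂ) (β : κ → ℂ)
    (hα : ∀ i ∈ A, ‖α i‖ ≤ 1) (hβ : ∀ j ∈ B, ‖β j‖ ≤ 1) (l : ℕ) :
    ∃ θ : ι → ℂ, (∀ i, ‖θ i‖ ≤ 1) ∧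
      ‖∑ i ∈ A, ∑ j ∈ B, α i * β j * ψ (u i * v j)‖ ^ (l + 1) ≤
        #A ^ l * ∑ y, repCount B v (l + 1) y * ‖∑ i ∈ A, θ i * ψ (u i * y)‖ := by
  classical
  let S : ι → ℂ := fun i => ∑ j ∈ B, β j * ψ (v j * u i)
  let θ : ι → ℂ := fun i => (starRingEnd ℂ) (S i ^ (l + 1)) / (‖S i ^ (l + 1)‖ : ℂ)
  have hθ : ∀ i, ‖θ i‖ ≤ 1 := by
    intro i
    simp only [θ, norm_div, RCLike.norm_conj, Complex.norm_real, norm_norm]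
    exact div_self_le_one _
  have hθS : ∀ i, θ i * S i ^ (l + 1) = (‖S i‖ : ℂ) ^ (l + 1) := by
    intro i
    by_cases h : S i ^ (l + 1) = 0
    · have : S i = 0 := by simpa using h
      simp [θ, this]
    · have h' : (‖S i ^ (l + 1)‖ : ℂ) ≠ 0 := by simpa using h
      simp only [θ]
      rw [div_mul_eq_mul_div, div_eq_iff h', mul_comm, Complex.mul_conj', norm_pow]
      push_cast
      ring
  refine ⟨θ, hθ, ?_⟩
  have h1 : ‖∑ i ∈ A, ∑ j ∈ B, α i * β j * ψ (u i * v j)‖ ≤ ∑ i ∈ A, ‖S i‖ := by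
    refine (norm_sum_le _ _).trans (sum_le_sum fun i hi => ?_)
    have : ∑ j ∈ B, α i * β j * ψ (u i * v j) = α i * S i := by
      simp only [S, mul_sum]
      refine sum_congr rfl fun j _ => ?_
      rw [mul_comm (u i), mul_assoc]
    rw [this, norm_mul]
    exact mul_le_of_le_one_left (norm_nonneg _) (hα i hi)
  have h2 : (∑ i ∈ A, ‖S i‖) ^ (l + 1) ≤ #A ^ l * ∑ i ∈ A, ‖S i‖ ^ (l + 1) := by
    exact pow_sum_le_card_mul_sum_pow (fun _ _ => norm_nonneg _) l
  have h3 : ((∑ i ∈ A, ‖S i‖ ^ (l + 1) : ℝ) : ℂ) =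
      ∑ s ∈ Fintype.piFinset (fun _ : Fin (l + 1) => B), (∏ j, β (s j)) *
        ∑ i ∈ A, θ i * ψ (u i * ∑ j, v (s j)) := by
    push_cast
    simp only [← hθS, S, pow_charSum, mul_sum]
    rw [sum_comm]
    refine sum_congr rfl fun s _ => sum_congr rfl fun i _ => ?_
    rw [← mul_sum, mul_comm (u i)]
    ring
  have h4 : ∑ i ∈ A, ‖S i‖ ^ (l + 1) ≤
      ∑ y, repCount B v (l + 1) y * ‖∑ i ∈ A, θ i * ψ (u i * y)‖ := by
    calc ∑ i ∈ A, ‖S i‖ ^ (l + 1) = ‖((∑ i ∈ A, ‖S i‖ ^ (l + 1) : ℝ) : ℂ)‖ := by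
          rw [Complex.norm_real, Real.norm_of_nonneg]
          positivity
      _ ≤ ∑ s ∈ Fintype.piFinset (fun _ : Fin (l + 1) => B),
            ‖∑ i ∈ A, θ i * ψ (u i * ∑ j, v (s j))‖ := by
          rw [h3]
          refine (norm_sum_le _ _).trans (sum_le_sum fun s hs => ?_)
          rw [norm_mul, norm_prod]
          refine mul_le_of_le_one_left (norm_nonneg _)
            (prod_le_one (fun _ _ => norm_nonneg _) fun j _ => hβ _ ?_)
          exact Fintype.mem_piFinset.1 hs j
      _ = _ := by
          rw [← sum_fiberwise _ (fun s => ∑ j, v (s j))]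
          refine sum_congr rfl fun y _ => ?_
          rw [repCount, ← nsmul_eq_mul, ← sum_const]
          refine sum_congr rfl fun s hs => ?_
          rw [(mem_filter.1 hs).2]
  calc _ ≤ (∑ i ∈ A, ‖S i‖) ^ (l + 1) := by gcongr
    _ ≤ _ := h2.trans (by gcongr)

/-- Cauchy–Schwarz twice, first with `f * g = √f * (√f * g)`. For `f = repCount` both moments of `f`
are known: a power of the cardinality and an energy. -/
theorem sum_mul_pow_four_le {ι : Type*} (s : Finset ι) (f g : ι → ℝ) (hf : ∀ y, 0 ≤ f y) :
    (∑ y ∈ s, f y * g y) ^ 4 ≤ (∑ y ∈ s, f y) ^ 2 * ((∑ y ∈ s, f y ^ 2) * ∑ y ∈ s, g y ^ 4) := by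
  have h1 : (∑ y ∈ s, f y * g y) ^ 2 ≤ (∑ y ∈ s, f y) * ∑ y ∈ s, f y * g y ^ 2 := by
    have := sum_mul_sq_le_sq_mul_sq s (fun y => √(f y)) (fun y => √(f y) * g y)
    simpa only [← mul_assoc, Real.mul_self_sqrt (hf _), mul_pow, Real.sq_sqrt (hf _)] using this
  have h2 : (∑ y ∈ s, f y * g y ^ 2) ^ 2 ≤ (∑ y ∈ s, f y ^ 2) * ∑ y ∈ s, g y ^ 4 := by
    have := sum_mul_sq_le_sq_mul_sq s f (fun y => g y ^ 2)
    simpa only [← pow_mul] using this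
  calc (∑ y ∈ s, f y * g y) ^ 4 = ((∑ y ∈ s, f y * g y) ^ 2) ^ 2 := by ring
    _ ≤ ((∑ y ∈ s, f y) * ∑ y ∈ s, f y * g y ^ 2) ^ 2 := pow_le_pow_left₀ (sq_nonneg _) h1 2
    _ = (∑ y ∈ s, f y) ^ 2 * (∑ y ∈ s, f y * g y ^ 2) ^ 2 := mul_pow _ _ _
    _ ≤ _ := mul_le_mul_of_nonneg_left h2 (sq_nonneg _)

theorem norm_bilinear_pow_le [Fintype R] {ι κ : Type*} {ψ : AddChar R ℂ} (hψ : ψ.IsPrimitive)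
    (A : Finset ι) (B : Finset κ) (u : ι → R) (v : κ → R) (α : ι → ℂ) (β : κ → ℂ)
    (hα : ∀ i ∈ A, ‖α i‖ ≤ 1) (hβ : ∀ j ∈ B, ‖β j‖ ≤ 1) (l : ℕ) :
    ‖∑ i ∈ A, ∑ j ∈ B, α i * β j * ψ (u i * v j)‖ ^ (4 * (l + 1)) ≤
      (#A : ℝ) ^ (4 * l) * ((#B : ℝ) ^ (2 * (l + 1)) * (energy B v (l + 1) *
        (Fintype.card R * energy A u 2))) := by
  obtain ⟨θ, hθ, h⟩ := norm_bilinear_pow_le_sum ψ A B u v α β hα hβ l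
  have h3 : ∑ y, (repCount B v (l + 1) y : ℝ) = (#B : ℝ) ^ (l + 1) := by
    rw [← Nat.cast_pow, ← sum_repCount B v (l + 1), Nat.cast_sum]
  have h4 : ∑ y, (repCount B v (l + 1) y : ℝ) ^ 2 = energy B v (l + 1) := by
    rw [← sum_repCount_sq B v (l + 1)]
    push_cast
    rfl
  have h5 := sum_norm_charSum_pow_le hψ A u θ (fun i _ => hθ i) 2
  have h6 := sum_mul_pow_four_le univ (fun y => (repCount B v (l + 1) y : ℝ))
    (fun y => ‖∑ i ∈ A, θ i * ψ (u i * y)‖) (fun y => Nat.cast_nonneg _)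
  rw [h3, h4, ← pow_mul, mul_comm (l + 1)] at h6
  rw [mul_comm 4, pow_mul]
  refine (pow_le_pow_left₀ (by positivity) h 4).trans ?_
  rw [mul_pow, ← pow_mul, mul_comm l]
  refine mul_le_mul_of_nonneg_left (h6.trans ?_) (by positivity)
  refine mul_le_mul_of_nonneg_left ?_ (by positivity)
  exact mul_le_mul_of_nonneg_left h5 (by positivity)

end Bilinear

/-! ### Residue classes in degree boxes and the divisor bound -/

section Divisors

open Finset

variable {K : Type*} [Field K] [Finite K]

variable (K) in
/-- The polynomials of degree less than `n`. -/
noncomputable def polysLT (n : ℕ) : Finset K[X] := (finite_degree_lt K n).toFinset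

theorem mem_polysLT {n : ℕ} {x : K[X]} : x ∈ polysLT K n ↔ x.degree < n := by
  simp [polysLT]

theorem mem_polysLT_of_ne_zero {n : ℕ} {x : K[X]} (hx : x ≠ 0) :
    x ∈ polysLT K n ↔ x.natDegree < n := by
  rw [mem_polysLT, natDegree_lt_iff_degree_lt hx]

theorem card_polysLT (n : ℕ) : #(polysLT K n) = Nat.card K ^ n := by
  have h : Nat.card (degreeLT K n) = Nat.card K ^ n := by
    rw [Nat.card_congr (degreeLTEquiv K n).toEquiv, Nat.card_fun, Nat.card_fin]
  rw [← h, ← Nat.card_eq_finsetCard]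
  exact Nat.card_congr (Equiv.subtypeEquivRight fun x => by rw [mem_polysLT, mem_degreeLT])

open Classical in
-- Members of one class are told apart by their quotients by `d`. Truncated subtraction gives the
-- bound 1 once deg d ≥ n.
theorem card_polysLT_congr_le (n : ℕ) {d : K[X]} (hd : d ≠ 0) (c : K[X]) :
    #{x ∈ polysLT K n | d ∣ x - c} ≤ Nat.card K ^ (n - d.natDegree) := by
  rw [← card_polysLT]
  refine card_le_card_of_injOn (fun x => x / d) ?_ ?_
  · intro x hx
    have hx := (mem_filter.1 hx).1
    show x / d ∈ polysLT K _
    by_cases h0 : x / d = 0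
    · rw [h0, mem_polysLT, degree_zero]
      exact WithBot.bot_lt_coe _
    · have hx0 : x ≠ 0 := by
        rintro rfl
        simp at h0
      rw [mem_polysLT_of_ne_zero h0]
      rw [mem_polysLT_of_ne_zero hx0] at hx
      have h1 : ¬ x.degree < d.degree := fun h => h0 ((Polynomial.div_eq_zero_iff hd).2 h)
      have h2 : d.natDegree ≤ x.natDegree := natDegree_le_natDegree (not_lt.1 h1)
      have h3 := degree_add_div hd (not_lt.1 h1)
      rw [degree_eq_natDegree hd, degree_eq_natDegree h0, degree_eq_natDegree hx0] at h3
      have h4 : d.natDegree + (x / d).natDegree = x.natDegree := by exact_mod_cast h3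
      omega
  · intro x hx y hy hxy
    have hx := (mem_filter.1 hx).2
    have hy := (mem_filter.1 hy).2
    have h1 : x % d = y % d := by
      rw [← sub_eq_zero, ← sub_mod, EuclideanDomain.mod_eq_zero]
      have := dvd_sub hx hy
      rwa [sub_sub_sub_cancel_right] at this
    rw [← EuclideanDomain.div_add_mod x d, ← EuclideanDomain.div_add_mod y d, h1]
    simp only at hxy
    rw [hxy]

open Classical in
-- Excluding 0 gives the exact density even for large deg d, where no multiple is left.
theorem card_polysLT_multiples_mul_le (n : ℕ) {d : K[X]} (hd : d ≠ 0) :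
    #{x ∈ polysLT K n | x ≠ 0 ∧ d ∣ x} * Nat.card K ^ d.natDegree ≤ Nat.card K ^ n := by
  by_cases h : d.natDegree ≤ n
  · calc _ ≤ Nat.card K ^ (n - d.natDegree) * Nat.card K ^ d.natDegree := by
          gcongr
          refine (card_le_card ?_).trans (card_polysLT_congr_le n hd 0)
          intro x
          simp only [mem_filter, sub_zero]
          tauto
      _ = _ := by rw [← pow_add, Nat.sub_add_cancel h]
  · rw [filter_false_of_mem]
    · simp
    · rintro x hx ⟨h0, h1⟩
      rw [mem_polysLT_of_ne_zero h0] at hx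
      have := natDegree_le_of_dvd h1 h0
      omega

open Classical in
/-- The divisors of a nonzero polynomial. -/
noncomputable def divs (x : K[X]) : Finset K[X] := {d ∈ polysLT K (x.natDegree + 1) | d ∣ x}

theorem mem_divs {x d : K[X]} (hx : x ≠ 0) : d ∈ divs x ↔ d ∣ x := by
  classical
  rw [divs, mem_filter, and_iff_right_iff_imp]
  intro h
  rw [mem_polysLT_of_ne_zero (ne_zero_of_dvd_ne_zero hx h)]
  have := natDegree_le_of_dvd h hx
  omega

open Classical UniqueFactorizationMonoid in
-- A divisor is determined by its leading coefficient and its multiset of monic prime factors.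
theorem card_divs_le_prod {x : K[X]} (hx : x ≠ 0) :
    #(divs x) ≤ Nat.card K *
      ∏ p ∈ (normalizedFactors x).toFinset, ((normalizedFactors x).count p + 1) := by
  have := Fintype.ofFinite K
  rw [← Multiset.card_Iic, Nat.card_eq_fintype_card, ← card_univ, ← card_product]
  refine card_le_card_of_injOn (fun d => (d.leadingCoeff, normalizedFactors d)) ?_ ?_
  · intro d hd
    have hd := (mem_divs hx).1 hd
    simp only [coe_product, coe_univ, Set.mem_prod, Set.mem_univ, true_and, mem_coe, mem_Iic]
    exact (dvd_iff_normalizedFactors_le_normalizedFactors (ne_zero_of_dvd_ne_zero hx hd) hx).1 hd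
  · intro d hd e he hde
    simp only [Prod.mk.injEq] at hde
    have hd0 := ne_zero_of_dvd_ne_zero hx ((mem_divs hx).1 hd)
    have he0 := ne_zero_of_dvd_ne_zero hx ((mem_divs hx).1 he)
    rw [← leadingCoeff_mul_prod_normalizedFactors d, ← leadingCoeff_mul_prod_normalizedFactors e,
      hde.1, hde.2]

open Classical UniqueFactorizationMonoid in
theorem sum_count_mul_natDegree {K : Type*} [Field K] {x : K[X]} (hx : x ≠ 0) :
    ∑ p ∈ (normalizedFactors x).toFinset, (normalizedFactors x).count p * p.natDegree =
      x.natDegree := by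
  have h1 := sum_multiset_map_count (normalizedFactors x) natDegree
  simp only [smul_eq_mul] at h1
  rw [← h1, ← natDegree_multiset_prod _ (zero_notMem_normalizedFactors x)]
  exact natDegree_eq_of_degree_eq (degree_eq_degree_of_associated (prod_normalizedFactors hx))

theorem exists_succ_le_mul_rpow {b : ℝ} (hb : 1 < b) :
    ∃ B : ℝ, 1 ≤ B ∧ ∀ e : ℕ, (e + 1 : ℝ) ≤ B * b ^ e := by
  have hb1 : 0 < b - 1 := by linarith
  refine ⟨1 + (b - 1)⁻¹, by simpa using hb1.le, fun e => ?_⟩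
  have h := one_add_mul_le_pow (a := b - 1) (by linarith) e
  rw [add_sub_cancel] at h
  have h1 : 1 ≤ b ^ e := one_le_pow₀ hb.le
  have h2 : (e : ℝ) ≤ (b - 1)⁻¹ * b ^ e := by
    rw [le_inv_mul_iff₀ hb1]
    linarith
  linarith

open Classical UniqueFactorizationMonoid in
/-- The divisor bound in `K[T]`. -/
theorem exists_card_divs_le (K : Type*) [Field K] [Finite K] {η : ℝ} (hη : 0 < η) :
    ∃ C : ℝ, 0 < C ∧ ∀ x : K[X], x ≠ 0 →
      (#(divs x) : ℝ) ≤ C * (Nat.card K : ℝ) ^ (η * x.natDegree) := by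
  have hq : (1 : ℝ) < Nat.card K := by exact_mod_cast Finite.one_lt_card
  set b : ℝ := (Nat.card K : ℝ) ^ η with hbdef
  have hb : 1 < b := Real.one_lt_rpow hq hη
  obtain ⟨B, hB1, hB⟩ := exists_succ_le_mul_rpow hb
  -- A prime of degree at least `D` has `b ^ deg ≥ 2`, so e + 1 ≤ 2^e costs no constant; only the
  -- finitely many primes of smaller degree each cost a factor `B`.
  obtain ⟨D, hD⟩ := pow_unbounded_of_one_lt 2 hb
  refine ⟨Nat.card K * B ^ #(polysLT K D), by positivity, fun x hx => ?_⟩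
  set M := normalizedFactors x with hM
  have hpow : (Nat.card K : ℝ) ^ (η * x.natDegree) =
      ∏ p ∈ M.toFinset, b ^ (M.count p * p.natDegree) := by
    rw [prod_pow_eq_pow_sum, sum_count_mul_natDegree hx, Real.rpow_mul (by positivity),
      Real.rpow_natCast]
  have hterm : ∀ p ∈ M.toFinset, ((M.count p + 1 : ℕ) : ℝ) ≤
      (if p.natDegree < D then B else 1) * b ^ (M.count p * p.natDegree) := by
    intro p hp
    have hirr := irreducible_of_normalized_factor p (Multiset.mem_toFinset.1 hp)
    have hdeg : 1 ≤ p.natDegree := hirr.natDegree_pos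
    push_cast
    split_ifs with h
    · refine (hB _).trans ?_
      gcongr
      · exact hb.le
      · exact Nat.le_mul_of_pos_right _ hdeg
    · rw [one_mul, mul_comm, pow_mul]
      have h2 : 2 ≤ b ^ p.natDegree := hD.le.trans (pow_le_pow_right₀ hb.le (not_lt.1 h))
      calc (M.count p + 1 : ℝ) ≤ 2 ^ M.count p := by
            exact_mod_cast Nat.succ_le_of_lt (Nat.lt_two_pow_self)
        _ ≤ _ := by gcongr
  calc (#(divs x) : ℝ) ≤ Nat.card K * ∏ p ∈ M.toFinset, ((M.count p + 1 : ℕ) : ℝ) := by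
        exact_mod_cast card_divs_le_prod hx
    _ ≤ Nat.card K * ∏ p ∈ M.toFinset,
          ((if p.natDegree < D then B else 1) * b ^ (M.count p * p.natDegree)) := by
        gcongr with p hp
        exact hterm p hp
    _ = Nat.card K * B ^ #{p ∈ M.toFinset | p.natDegree < D} *
          (Nat.card K : ℝ) ^ (η * x.natDegree) := by
        rw [prod_mul_distrib, ← hpow, prod_ite, prod_const, prod_const_one, mul_one, mul_assoc]
    _ ≤ _ := by
        gcongr
        intro p hp
        obtain ⟨h1, h2⟩ := mem_filter.1 hp
        have hirr := irreducible_of_normalized_factor p (Multiset.mem_toFinset.1 h1)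
        exact (mem_polysLT_of_ne_zero hirr.ne_zero).2 h2

end Divisors

/-! ### Numerators of sums of reciprocals, squarefull polynomials -/

section Tuples

open Finset

variable {K : Type*} [Field K] {k : ℕ}

/-- The sum over `i` of the product of all entries of `s` but the `i`-th one, i.e. the numerator of
`∑ i, 1 / s i` over the denominator `∏ i, s i`. -/
noncomputable def recipNum (s : Fin k → K[X]) : K[X] := ∑ i, ∏ j ∈ univ.erase i, s j

theorem mk_recipNum {F : K[X]} {s : Fin k → K[X]} (hs : ∀ i, IsCoprime (s i) F) :
    AdjoinRoot.mk F (recipNum s) =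
      AdjoinRoot.mk F (∏ i, s i) * ∑ i, AdjoinRoot.mk F (invMod F (s i)) := by
  rw [recipNum, map_sum, mul_sum]
  refine sum_congr rfl fun i _ => ?_
  rw [← mul_prod_erase univ s (mem_univ i), map_mul]
  linear_combination (-AdjoinRoot.mk F (∏ j ∈ univ.erase i, s j)) * mk_mul_mk_invMod (hs i)

theorem dvd_of_sum_invMod_eq {F : K[X]} {s t : Fin k → K[X]} (hs : ∀ i, IsCoprime (s i) F)
    (ht : ∀ i, IsCoprime (t i) F)
    (h : ∑ i, AdjoinRoot.mk F (invMod F (s i)) = ∑ i, AdjoinRoot.mk F (invMod F (t i))) :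
    F ∣ (∏ i, t i) * recipNum s - (∏ i, s i) * recipNum t := by
  rw [← AdjoinRoot.mk_eq_zero, map_sub, map_mul, map_mul, mk_recipNum hs, mk_recipNum ht, h]
  ring

theorem dvd_prod_erase {s : Fin k → K[X]} {p : K[X]} {i : Fin k} (hi : p ∣ s i)
    (h : p ∣ recipNum s) : p ∣ ∏ j ∈ univ.erase i, s j := by
  rw [recipNum, ← add_sum_erase univ _ (mem_univ i)] at h
  refine (dvd_add_left (dvd_sum fun j hj => ?_)).1 h
  exact hi.trans (dvd_prod_of_mem s (mem_erase.2 ⟨(ne_of_mem_erase hj).symm, mem_univ _⟩))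

/-- If `p` does not divide `∏ t`, it divides `recipNum s`. With `p ∣ s i`, every term but the `i`-th
is divisible by `p`, hence so is the `i`-th, which is the product of the other entries: this is the
second factor `p`. -/
theorem sq_dvd_of_recipNum_eq_aux {s t : Fin k → K[X]}
    (h : (∏ i, t i) * recipNum s = (∏ i, s i) * recipNum t) {p : K[X]} (hp : Prime p)
    (hps : p ∣ ∏ i, s i) : p ^ 2 ∣ (∏ i, s i) * ∏ i, t i := by
  by_cases hpt : p ∣ ∏ i, t i
  · rw [sq]
    exact mul_dvd_mul hps hpt
  obtain ⟨i, _, hi⟩ := (hp.dvd_finsetProd_iff s).1 hps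
  have h1 : p ∣ recipNum s := by
    have : p ∣ (∏ i, t i) * recipNum s := h ▸ hps.mul_right _
    exact (hp.dvd_or_dvd this).resolve_left hpt
  rw [sq, ← mul_prod_erase univ s (mem_univ i)]
  exact (mul_dvd_mul hi (dvd_prod_erase hi h1)).mul_right _

theorem sq_dvd_of_recipNum_eq {s t : Fin k → K[X]}
    (h : (∏ i, t i) * recipNum s = (∏ i, s i) * recipNum t) {p : K[X]} (hp : Prime p)
    (hpst : p ∣ (∏ i, s i) * ∏ i, t i) : p ^ 2 ∣ (∏ i, s i) * ∏ i, t i := by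
  rcases hp.dvd_or_dvd hpst with h1 | h1
  · exact sq_dvd_of_recipNum_eq_aux h hp h1
  · rw [mul_comm]
    exact sq_dvd_of_recipNum_eq_aux h.symm hp h1

/-- For a prime power p^e with e ≥ 2 take a = p^⌊e/2⌋. Thus squarefull polynomials are, up to
divisors of a, as rare as squares. -/
theorem exists_sq_dvd_dvd_cube {x : K[X]} (hx : x ≠ 0)
    (h : ∀ p : K[X], Prime p → p ∣ x → p ^ 2 ∣ x) : ∃ a : K[X], a ^ 2 ∣ x ∧ x ∣ a ^ 3 := by
  induction x using UniqueFactorizationMonoid.induction_on_coprime with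
  | h0 => exact absurd rfl hx
  | h1 u => exact ⟨1, by simp, u.dvd⟩
  | hpr i hp =>
    rename_i p
    rcases i with _ | _ | i
    · exact ⟨1, by simp, by simp⟩
    · exfalso
      have h1 := h p hp (by simp)
      rw [zero_add, pow_one, sq] at h1
      exact hp.not_isUnit (isUnit_of_dvd_one
        ((mul_dvd_mul_iff_left hp.ne_zero).1 (by simpa using h1)))
    · refine ⟨p ^ ((i + 1 + 1) / 2), ?_, ?_⟩
      · rw [← pow_mul]
        exact pow_dvd_pow _ (by omega)
      · rw [← pow_mul]
        exact pow_dvd_pow _ (by omega)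
  | hcp hxy hx' hy' =>
    rename_i x y
    have hx0 : x ≠ 0 := left_ne_zero_of_mul hx
    have hy0 : y ≠ 0 := right_ne_zero_of_mul hx
    have hcop : IsCoprime x y := hxy.isCoprime
    obtain ⟨a, ha1, ha2⟩ := hx' hx0 fun p hp hpx => by
      have h2 := h p hp (hpx.mul_right _)
      have h3 : IsCoprime (p ^ 2) y := (hcop.of_isCoprime_of_dvd_left hpx).pow_left
      exact h3.dvd_of_dvd_mul_right h2
    obtain ⟨b, hb1, hb2⟩ := hy' hy0 fun p hp hpy => by
      have h2 := h p hp (hpy.mul_left _)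
      have h3 : IsCoprime (p ^ 2) x := (hcop.symm.of_isCoprime_of_dvd_left hpy).pow_left
      exact h3.dvd_of_dvd_mul_left h2
    exact ⟨a * b, by rw [mul_pow]; exact mul_dvd_mul ha1 hb1,
      by rw [mul_pow]; exact mul_dvd_mul ha2 hb2⟩

/-- Replaces one condition on a product by independent conditions on its factors, with few choices
of `f`. -/
theorem exists_dvd_of_dvd_prod {ι : Type*} (T : Finset ι) (s : ι → K[X]) (g : K[X])
    (h : g ∣ ∏ i ∈ T, s i) :
    ∃ f : ι → K[X], (∀ i, f i ∣ s i ∧ f i ∣ g) ∧ g ∣ ∏ i ∈ T, f i := by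
  classical
  induction T using Finset.induction_on generalizing g with
  | empty => exact ⟨fun _ => 1, fun i => ⟨one_dvd _, one_dvd _⟩, by simpa using h⟩
  | insert a T ha ih =>
    rw [prod_insert ha] at h
    obtain ⟨g₁, g₂, h1, h2, rfl⟩ := exists_dvd_and_dvd_of_dvd_mul h
    obtain ⟨f, hf, hf'⟩ := ih g₂ h2
    refine ⟨Function.update f a g₁, fun i => ?_, ?_⟩
    · by_cases hi : i = a
      · subst hi
        simpa using h1
      · rw [Function.update_of_ne hi]
        exact ⟨(hf i).1, (hf i).2.mul_left _⟩
    · rw [prod_insert ha, Function.update_self, prod_update_of_notMem ha]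
      exact mul_dvd_mul_left _ hf'

end Tuples

/-! ### Tuples in a box with prescribed divisors of the product -/

section Box

open Finset

variable {K : Type*} [Field K] [Finite K]

open Classical in
variable (K) in
/-- The nonzero polynomials of degree less than `n`. -/
noncomputable def nzLT (n : ℕ) : Finset K[X] := {x ∈ polysLT K n | x ≠ 0}

theorem mem_nzLT {n : ℕ} {x : K[X]} : x ∈ nzLT K n ↔ x ≠ 0 ∧ x.natDegree < n := by
  classical
  rw [nzLT, mem_filter, and_comm]
  exact and_congr_right fun h => mem_polysLT_of_ne_zero h

theorem mem_coprimeLT {F : K[X]} {n : ℕ} {x : K[X]} :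
    x ∈ coprimeLT F n ↔ x.degree < n ∧ IsCoprime x F := by
  simp [coprimeLT]

theorem coprimeLT_subset_nzLT {F : K[X]} (hF : 0 < F.natDegree) (n : ℕ) :
    coprimeLT F n ⊆ nzLT K n := by
  intro x hx
  rw [mem_coprimeLT] at hx
  have h0 : x ≠ 0 := by
    rintro rfl
    have := natDegree_eq_zero_of_isUnit (isCoprime_zero_left.1 hx.2)
    omega
  exact mem_nzLT.2 ⟨h0, (natDegree_lt_iff_degree_lt h0).2 hx.1⟩

variable (K) in
/-- The `k`-tuples of nonzero polynomials of degree less than `n`. -/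
noncomputable def box (k n : ℕ) : Finset (Fin k → K[X]) :=
  Fintype.piFinset fun _ => nzLT K n

variable {k n : ℕ}

theorem mem_box {s : Fin k → K[X]} : s ∈ box K k n ↔ ∀ i, s i ≠ 0 ∧ (s i).natDegree < n := by
  simp [box, mem_nzLT]

theorem prod_ne_zero_of_mem_box {s : Fin k → K[X]} (hs : s ∈ box K k n) : ∏ i, s i ≠ 0 :=
  prod_ne_zero_iff.2 fun i _ => (mem_box.1 hs i).1

theorem natDegree_prod_le_of_mem_box {s : Fin k → K[X]} (hs : s ∈ box K k n)
    (T : Finset (Fin k)) : (∏ i ∈ T, s i).natDegree ≤ #T * (n - 1) := by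
  refine (natDegree_prod_le _ _).trans ?_
  rw [← smul_eq_mul]
  refine sum_le_card_nsmul _ _ _ fun i _ => ?_
  have := (mem_box.1 hs i).2
  omega

theorem natDegree_recipNum_le {s : Fin k → K[X]} (hs : s ∈ box K k n) :
    (recipNum s).natDegree ≤ (k - 1) * (n - 1) := by
  refine natDegree_sum_le_of_forall_le _ _ fun i _ => ?_
  refine (natDegree_prod_le_of_mem_box hs _).trans ?_
  rw [card_erase_of_mem (mem_univ i), card_univ, Fintype.card_fin]

open Classical in
theorem card_box_prod_eq_le {x : K[X]} (hx : x ≠ 0) :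
    #{s ∈ box K k n | ∏ i, s i = x} ≤ #(divs x) ^ k := by
  have h : #(Fintype.piFinset fun _ : Fin k => divs x) = #(divs x) ^ k := by
    rw [Fintype.card_piFinset]; simp
  rw [← h]
  refine card_le_card fun s hs => Fintype.mem_piFinset.2 fun i => ?_
  rw [mem_divs hx, ← (mem_filter.1 hs).2]
  exact dvd_prod_of_mem _ (mem_univ i)

open Classical in
-- Each tuple has `f i ∣ s i` for one of at most `#(divs g) ^ k` tuples `f` with `g ∣ ∏ f i`, and
-- those conditions have density at most q^(-deg g).
theorem card_box_dvd_prod_mul_le {g : K[X]} (hg : g ≠ 0) :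
    #{s ∈ box K k n | g ∣ ∏ i, s i} * Nat.card K ^ g.natDegree ≤
      #(divs g) ^ k * Nat.card K ^ (k * n) := by
  let Φ : Finset (Fin k → K[X]) := {f ∈ Fintype.piFinset fun _ => divs g | g ∣ ∏ i, f i}
  have hsub : {s ∈ box K k n | g ∣ ∏ i, s i} ⊆
      Φ.biUnion fun f => Fintype.piFinset fun i => {x ∈ polysLT K n | x ≠ 0 ∧ f i ∣ x} := by
    intro s hs
    obtain ⟨hs, hgs⟩ := mem_filter.1 hs
    obtain ⟨f, hf, hgf⟩ := exists_dvd_of_dvd_prod univ s g hgs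
    refine mem_biUnion.2 ⟨f, mem_filter.2 ⟨Fintype.mem_piFinset.2 fun i =>
      (mem_divs hg).2 (hf i).2, hgf⟩, Fintype.mem_piFinset.2 fun i => mem_filter.2 ?_⟩
    have h0 := (mem_box.1 hs i).1
    exact ⟨(mem_polysLT_of_ne_zero h0).2 (mem_box.1 hs i).2, h0, (hf i).1⟩
  have hΦ : #Φ ≤ #(divs g) ^ k := by
    refine (card_filter_le _ _).trans ?_
    rw [Fintype.card_piFinset]
    simp
  calc _ ≤ (∑ f ∈ Φ, #(Fintype.piFinset fun i => {x ∈ polysLT K n | x ≠ 0 ∧ f i ∣ x})) *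
        Nat.card K ^ g.natDegree := by
        gcongr
        exact (card_le_card hsub).trans card_biUnion_le
    _ ≤ ∑ f ∈ Φ, Nat.card K ^ (k * n) := by
        rw [sum_mul]
        refine sum_le_sum fun f hf => ?_
        obtain ⟨hf, hgf⟩ := mem_filter.1 hf
        have hf0 : ∀ i, f i ≠ 0 := fun i =>
          ne_zero_of_dvd_ne_zero hg ((mem_divs hg).1 (Fintype.mem_piFinset.1 hf i))
        have hdeg : g.natDegree ≤ ∑ i, (f i).natDegree := by
          rw [← natDegree_prod _ _ fun i _ => hf0 i]
          exact natDegree_le_of_dvd hgf (prod_ne_zero_iff.2 fun i _ => hf0 i)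
        calc _ ≤ (∏ i, #{x ∈ polysLT K n | x ≠ 0 ∧ f i ∣ x}) *
              ∏ i, Nat.card K ^ (f i).natDegree := by
              rw [Fintype.card_piFinset, prod_pow_eq_pow_sum]
              gcongr
              exact Nat.card_pos
          _ ≤ ∏ _i : Fin k, Nat.card K ^ n := by
              rw [← prod_mul_distrib]
              exact prod_le_prod' fun i _ => card_polysLT_multiples_mul_le n (hf0 i)
          _ = Nat.card K ^ (k * n) := by simp [← pow_mul, mul_comm]
    _ = #Φ * Nat.card K ^ (k * n) := by rw [sum_const, smul_eq_mul]
    _ ≤ _ := by gcongr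

end Box

/-! ### The energy of order k of the inverses -/

section ReciprocalEnergy

open Finset

variable {K : Type*} [Field K] [Finite K] {k n D : ℕ}

open Classical in
/-- The pairs of tuples whose sums of reciprocals differ by `c / (∏ s i * ∏ t i)`. -/
noncomputable def diffPairs (K : Type*) [Field K] [Finite K] (k n : ℕ) (c : K[X]) :
    Finset ((Fin k → K[X]) × (Fin k → K[X])) :=
  {p ∈ box K k n ×ˢ box K k n |
    (∏ i, p.2 i) * recipNum p.1 - (∏ i, p.1 i) * recipNum p.2 = c}

theorem mem_diffPairs {c : K[X]} {p : (Fin k → K[X]) × (Fin k → K[X])} :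
    p ∈ diffPairs K k n c ↔ (p.1 ∈ box K k n ∧ p.2 ∈ box K k n) ∧
      (∏ i, p.2 i) * recipNum p.1 - (∏ i, p.1 i) * recipNum p.2 = c := by
  classical
  rw [diffPairs, mem_filter, mem_product]

theorem natDegree_prod_univ_le {s : Fin k → K[X]} (hs : s ∈ box K k n) :
    (∏ i, s i).natDegree ≤ k * (n - 1) := by
  simpa using natDegree_prod_le_of_mem_box hs univ

theorem mul_sub_one_le (k n : ℕ) : k * (n - 1) ≤ k * n := Nat.mul_le_mul_left k (Nat.sub_le n 1)

open Classical in
-- The product of all 2k entries is squarefull, so it is a²b with b ∣ a and deg a < kn. The divisor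
-- bound recovers the entries from it.
theorem card_diffPairs_zero_le (hk : 1 ≤ k) (hn : 1 ≤ n)
    (hD : ∀ x : K[X], x ≠ 0 → x.natDegree ≤ 2 * k * n → #(divs x) ≤ D) :
    #(diffPairs K k n 0) ≤ D ^ (2 * k + 1) * Nat.card K ^ (k * n) := by
  let W : Finset K[X] := (nzLT K (k * n)).biUnion fun a => (divs a).image fun b => a ^ 2 * b
  have hlt : k * (n - 1) < k * n := Nat.mul_lt_mul_of_pos_left (by omega) hk
  have hW : #W ≤ Nat.card K ^ (k * n) * D := by
    refine card_biUnion_le.trans ?_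
    calc _ ≤ ∑ a ∈ nzLT K (k * n), D := by
          refine sum_le_sum fun a ha => card_image_le.trans (hD a (mem_nzLT.1 ha).1 ?_)
          have := (mem_nzLT.1 ha).2
          linarith
      _ ≤ _ := by
          rw [sum_const, smul_eq_mul, ← card_polysLT]
          gcongr
          exact filter_subset _ _
  have hmaps : ∀ p ∈ diffPairs K k n 0, (∏ i, p.1 i) * ∏ i, p.2 i ∈ W := by
    intro p hp
    obtain ⟨⟨h1, h2⟩, h3⟩ := mem_diffPairs.1 hp
    have h0 : (∏ i, p.1 i) * ∏ i, p.2 i ≠ 0 :=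
      mul_ne_zero (prod_ne_zero_of_mem_box h1) (prod_ne_zero_of_mem_box h2)
    obtain ⟨a, ha1, ha2⟩ := exists_sq_dvd_dvd_cube h0
      fun q hq => sq_dvd_of_recipNum_eq (sub_eq_zero.1 h3) hq
    obtain ⟨b, hb⟩ := ha1
    have ha0 : a ≠ 0 := by
      rintro rfl
      simp at hb
      exact h0 (by simpa using hb)
    have hb0 : b ≠ 0 := by
      rintro rfl
      exact h0 (by simpa using hb)
    have hba : b ∣ a := by
      rw [hb, pow_succ a 2] at ha2
      exact (mul_dvd_mul_iff_left (pow_ne_zero 2 ha0)).1 ha2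
    refine mem_biUnion.2 ⟨a, mem_nzLT.2 ⟨ha0, ?_⟩, mem_image.2 ⟨b, (mem_divs ha0).2 hba, hb.symm⟩⟩
    have h4 := congrArg natDegree hb
    rw [natDegree_mul (prod_ne_zero_of_mem_box h1) (prod_ne_zero_of_mem_box h2),
      natDegree_mul (pow_ne_zero 2 ha0) hb0, natDegree_pow] at h4
    have h5 := natDegree_prod_univ_le h1
    have h6 := natDegree_prod_univ_le h2
    omega
  have hfib : ∀ w ∈ W, #{p ∈ diffPairs K k n 0 | (∏ i, p.1 i) * ∏ i, p.2 i = w} ≤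
      D ^ (2 * k) := by
    intro w _
    rcases eq_empty_or_nonempty {p ∈ diffPairs K k n 0 | (∏ i, p.1 i) * ∏ i, p.2 i = w} with h | h
    · rw [h]
      simp
    obtain ⟨p₀, hp₀⟩ := h
    obtain ⟨hp₀, hw⟩ := mem_filter.1 hp₀
    obtain ⟨⟨h1, h2⟩, -⟩ := mem_diffPairs.1 hp₀
    have hw0 : w ≠ 0 := by
      rw [← hw]
      exact mul_ne_zero (prod_ne_zero_of_mem_box h1) (prod_ne_zero_of_mem_box h2)
    have hwd : #(divs w) ≤ D := by
      refine hD w hw0 ?_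
      rw [← hw, natDegree_mul (prod_ne_zero_of_mem_box h1) (prod_ne_zero_of_mem_box h2)]
      have h5 := natDegree_prod_univ_le h1
      have h6 := natDegree_prod_univ_le h2
      linarith
    calc _ ≤ #((Fintype.piFinset fun _ : Fin k => divs w) ×ˢ
          Fintype.piFinset fun _ : Fin k => divs w) := by
          refine card_le_card fun p hp => ?_
          obtain ⟨-, hp⟩ := mem_filter.1 hp
          rw [mem_product, Fintype.mem_piFinset, Fintype.mem_piFinset]
          refine ⟨fun i => (mem_divs hw0).2 ?_, fun i => (mem_divs hw0).2 ?_⟩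
          · rw [← hp]
            exact (dvd_prod_of_mem _ (mem_univ i)).mul_right _
          · rw [← hp]
            exact (dvd_prod_of_mem _ (mem_univ i)).mul_left _
      _ = #(divs w) ^ (2 * k) := by
          rw [card_product, Fintype.card_piFinset]
          simp only [prod_const, card_univ, Fintype.card_fin]
          ring
      _ ≤ _ := by gcongr
  calc _ ≤ D ^ (2 * k) * #W := card_le_mul_card_image_of_maps_to hmaps _ hfib
    _ ≤ D ^ (2 * k) * (Nat.card K ^ (k * n) * D) := by gcongr
    _ = _ := by ring

open Classical in
-- Let P = ∏ s i, g = gcd(P, `recipNum s`) and h = P / g. Subtracting the equations of two solutions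
-- and cancelling g puts `∏ t i` in a fixed class mod h. As its degree is at most deg P, q^(deg g +
-- 1) products remain. Since g ∣ c, summing over all divisors of c removes the dependence of g on
-- `s`.
theorem card_fiber_le (hD : ∀ x : K[X], x ≠ 0 → x.natDegree ≤ 2 * k * n → #(divs x) ≤ D)
    {c : K[X]} (hc : c ≠ 0) {s : Fin k → K[X]} (hs : s ∈ box K k n) :
    #{t ∈ box K k n | (∏ i, t i) * recipNum s - (∏ i, s i) * recipNum t = c ∧
        (∏ i, t i).natDegree ≤ (∏ i, s i).natDegree} ≤
      ∑ g ∈ divs c, if g ∣ ∏ i, s i then D ^ k * Nat.card K ^ (g.natDegree + 1) else 0 := by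
  set T := {t ∈ box K k n | (∏ i, t i) * recipNum s - (∏ i, s i) * recipNum t = c ∧
        (∏ i, t i).natDegree ≤ (∏ i, s i).natDegree} with hT
  rcases eq_empty_or_nonempty T with h | ⟨t₀, ht₀⟩
  · rw [h]
    simp
  obtain ⟨ht₀, h₀, -⟩ := mem_filter.1 ht₀
  have hP0 := prod_ne_zero_of_mem_box hs
  set P := ∏ i, s i with hP
  set g := EuclideanDomain.gcd P (recipNum s) with hg
  have hg0 : g ≠ 0 := fun h => hP0 (EuclideanDomain.gcd_eq_zero_iff.1 h).1
  obtain ⟨h, hh⟩ := EuclideanDomain.gcd_dvd_left P (recipNum s)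
  obtain ⟨a, ha⟩ := EuclideanDomain.gcd_dvd_right P (recipNum s)
  rw [← hg] at hh ha
  have hh0 : h ≠ 0 := by
    rintro rfl
    exact hP0 (by simpa using hh)
  have hcop : IsCoprime a h := by
    refine ⟨EuclideanDomain.gcdB P (recipNum s), EuclideanDomain.gcdA P (recipNum s), ?_⟩
    have h1 := EuclideanDomain.gcd_eq_gcd_ab P (recipNum s)
    rw [← hg] at h1
    refine mul_left_cancel₀ hg0 ?_
    linear_combination (-1 : K[X]) * h1 - (EuclideanDomain.gcdB P (recipNum s)) * ha -
      (EuclideanDomain.gcdA P (recipNum s)) * hh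
  have hgc : g ∣ c := by
    rw [← h₀, ha]
    exact dvd_sub ((dvd_mul_right g a).mul_left _) ((Dvd.intro _ hh.symm).mul_right _)
  have hgdeg : P.natDegree = g.natDegree + h.natDegree := by rw [hh, natDegree_mul hg0 hh0]
  have hcong : ∀ t ∈ T, h ∣ ∏ i, t i - ∏ i, t₀ i := by
    intro t ht
    obtain ⟨-, h2, -⟩ := mem_filter.1 ht
    refine hcop.symm.dvd_of_dvd_mul_left ⟨recipNum t - recipNum t₀, mul_left_cancel₀ hg0 ?_⟩
    linear_combination h2 - h₀ - (∏ i, t i - ∏ i, t₀ i) * ha +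
      (recipNum t - recipNum t₀) * hh
  have hmaps : ∀ t ∈ T, ∏ i, t i ∈
      {w ∈ polysLT K (P.natDegree + 1) | h ∣ w - ∏ i, t₀ i} := by
    intro t ht
    refine mem_filter.2 ⟨?_, hcong t ht⟩
    obtain ⟨h1, -, h2⟩ := mem_filter.1 ht
    change _ ≤ P.natDegree at h2
    rw [mem_polysLT_of_ne_zero (prod_ne_zero_of_mem_box h1)]
    omega
  have hfib : ∀ w ∈ ({w ∈ polysLT K (P.natDegree + 1) | h ∣ w - ∏ i, t₀ i} : Finset K[X]),
      #{t ∈ T | ∏ i, t i = w} ≤ D ^ k := by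
    intro w _
    rcases eq_empty_or_nonempty {t ∈ T | ∏ i, t i = w} with h | ⟨t, ht⟩
    · rw [h]
      simp
    obtain ⟨ht, hw⟩ := mem_filter.1 ht
    have htb := (mem_filter.1 ht).1
    have hw0 : w ≠ 0 := hw ▸ prod_ne_zero_of_mem_box htb
    calc _ ≤ #{t ∈ box K k n | ∏ i, t i = w} := by
          gcongr
          exact filter_subset _ _
      _ ≤ #(divs w) ^ k := card_box_prod_eq_le hw0
      _ ≤ D ^ k := by
          gcongr
          refine hD w hw0 ?_
          rw [← hw]
          have h5 := natDegree_prod_univ_le htb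
          have h6 := mul_sub_one_le k n
          linarith
  calc #T ≤ D ^ k * #{w ∈ polysLT K (P.natDegree + 1) | h ∣ w - ∏ i, t₀ i} :=
        card_le_mul_card_image_of_maps_to hmaps _ hfib
    _ ≤ D ^ k * Nat.card K ^ (P.natDegree + 1 - h.natDegree) := by
        gcongr
        exact card_polysLT_congr_le _ hh0 _
    _ = if g ∣ P then D ^ k * Nat.card K ^ (g.natDegree + 1) else 0 := by
        rw [if_pos (Dvd.intro _ hh.symm), hgdeg]
        congr 2
        omega
    _ ≤ _ := single_le_sum (f := fun g => if g ∣ P then D ^ k * Nat.card K ^ (g.natDegree + 1)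
          else 0) (fun _ _ => Nat.zero_le _) ((mem_divs hc).2 hgc)

open Classical in
-- After the sums are exchanged, the density q^(-deg g) of the `s` with `g ∣ ∏ s i` cancels the
-- q^(deg g) choices in the fibre.
theorem card_half_diffPairs_le
    (hD : ∀ x : K[X], x ≠ 0 → x.natDegree ≤ 2 * k * n → #(divs x) ≤ D)
    {c : K[X]} (hc : c ≠ 0) (hcdeg : c.natDegree ≤ 2 * k * n) :
    #{p ∈ diffPairs K k n c | (∏ i, p.2 i).natDegree ≤ (∏ i, p.1 i).natDegree} ≤
      Nat.card K * D ^ (2 * k + 1) * Nat.card K ^ (k * n) := by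
  calc _ = #{p ∈ box K k n ×ˢ box K k n |
        (∏ i, p.2 i) * recipNum p.1 - (∏ i, p.1 i) * recipNum p.2 = c ∧
          (∏ i, p.2 i).natDegree ≤ (∏ i, p.1 i).natDegree} := by
        rw [diffPairs, filter_filter]
    _ = ∑ s ∈ box K k n, #{t ∈ box K k n | (∏ i, t i) * recipNum s - (∏ i, s i) * recipNum t = c ∧
        (∏ i, t i).natDegree ≤ (∏ i, s i).natDegree} := by
        simp only [card_filter, sum_product]
    _ ≤ ∑ s ∈ box K k n, ∑ g ∈ divs c,
          if g ∣ ∏ i, s i then D ^ k * Nat.card K ^ (g.natDegree + 1) else 0 :=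
        sum_le_sum fun s hs => card_fiber_le hD hc hs
    _ = ∑ g ∈ divs c, #{s ∈ box K k n | g ∣ ∏ i, s i} *
          (D ^ k * Nat.card K ^ (g.natDegree + 1)) := by
        rw [sum_comm]
        refine sum_congr rfl fun g _ => ?_
        rw [← sum_filter, sum_const, smul_eq_mul]
    _ ≤ ∑ g ∈ divs c, Nat.card K * D ^ (2 * k) * Nat.card K ^ (k * n) := by
        refine sum_le_sum fun g hg => ?_
        have hgc := (mem_divs hc).1 hg
        have hg0 := ne_zero_of_dvd_ne_zero hc hgc
        calc _ = #{s ∈ box K k n | g ∣ ∏ i, s i} * Nat.card K ^ g.natDegree *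
                (D ^ k * Nat.card K) := by ring
          _ ≤ #(divs g) ^ k * Nat.card K ^ (k * n) * (D ^ k * Nat.card K) :=
              Nat.mul_le_mul_right _ (card_box_dvd_prod_mul_le hg0)
          _ ≤ D ^ k * Nat.card K ^ (k * n) * (D ^ k * Nat.card K) := by
              gcongr
              exact hD g hg0 ((natDegree_le_of_dvd hgc hc).trans hcdeg)
          _ = _ := by ring
    _ = #(divs c) * (Nat.card K * D ^ (2 * k) * Nat.card K ^ (k * n)) := by
        rw [sum_const, smul_eq_mul]
    _ ≤ D * (Nat.card K * D ^ (2 * k) * Nat.card K ^ (k * n)) := by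
        gcongr
        exact hD c hc hcdeg
    _ = _ := by ring

theorem card_diffPairs_le
    (hD : ∀ x : K[X], x ≠ 0 → x.natDegree ≤ 2 * k * n → #(divs x) ≤ D)
    {c : K[X]} (hc : c ≠ 0) (hcdeg : c.natDegree ≤ 2 * k * n) :
    #(diffPairs K k n c) ≤ 2 * (Nat.card K * D ^ (2 * k + 1) * Nat.card K ^ (k * n)) := by
  classical
  rw [← card_filter_add_card_filter_not
    (fun p => (∏ i, p.2 i).natDegree ≤ (∏ i, p.1 i).natDegree), two_mul]
  refine Nat.add_le_add (card_half_diffPairs_le hD hc hcdeg) ?_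
  -- Swapping the two tuples negates `c` and exchanges the halves.
  refine le_trans ?_ (card_half_diffPairs_le hD (neg_ne_zero.2 hc) (by rwa [natDegree_neg]))
  refine card_le_card_of_injOn Prod.swap ?_ Prod.swap_injective.injOn
  intro p hp
  obtain ⟨h1, h2⟩ := mem_filter.1 hp
  obtain ⟨⟨h3, h4⟩, h5⟩ := mem_diffPairs.1 h1
  refine mem_coe.2 (mem_filter.2 ⟨mem_diffPairs.2 ⟨⟨h4, h3⟩, ?_⟩, ?_⟩)
  · rw [← h5]
    simp
  · simp only [Prod.fst_swap, Prod.snd_swap]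
    omega

/-- The cleared congruence is an equation with right-hand side `F * c` of degree at most
(2k-1)(n-1), so deg c < (2k-1)n - deg F; a truncated difference 0 leaves only c = 0. -/
theorem energy_inv_le {F : K[X]} (hF : 0 < F.natDegree) (hk : 1 ≤ k) (hn : 1 ≤ n)
    (hD : ∀ x : K[X], x ≠ 0 → x.natDegree ≤ 2 * k * n → #(divs x) ≤ D) :
    energy (coprimeLT F n) (fun x => AdjoinRoot.mk F (invMod F x)) k ≤
      2 * Nat.card K * D ^ (2 * k + 1) *
        Nat.card K ^ (k * n + ((2 * k - 1) * n - F.natDegree)) := by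
  classical
  set X := (2 * k - 1) * n - F.natDegree with hX
  have hF0 : F ≠ 0 := by
    rintro rfl
    simp at hF
  have hq : 1 ≤ Nat.card K := Nat.card_pos
  have hdeg : ∀ s ∈ box K k n, ∀ t ∈ box K k n,
      ((∏ i, t i) * recipNum s - (∏ i, s i) * recipNum t).natDegree ≤ (2 * k - 1) * (n - 1) := by
    intro s hs t ht
    have h1 := natDegree_recipNum_le hs
    have h2 := natDegree_recipNum_le ht
    have h3 := natDegree_prod_univ_le hs
    have h4 := natDegree_prod_univ_le ht
    have h5 : (2 * k - 1) * (n - 1) = k * (n - 1) + (k - 1) * (n - 1) := by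
      rw [← add_mul]
      congr 1
      omega
    refine (natDegree_sub_le _ _).trans (max_le ?_ ?_)
    · exact natDegree_mul_le.trans (by omega)
    · exact natDegree_mul_le.trans (by omega)
  have hle : (2 * k - 1) * (n - 1) ≤ 2 * k * n := Nat.mul_le_mul (by omega) (by omega)
  have hlt : (2 * k - 1) * (n - 1) < (2 * k - 1) * n :=
    Nat.mul_lt_mul_of_pos_left (by omega) (by omega)
  have hsub : energy (coprimeLT F n) (fun x => AdjoinRoot.mk F (invMod F x)) k ≤
      #((polysLT K X).biUnion fun c => diffPairs K k n (F * c)) := by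
    unfold energy
    refine card_le_card fun p hp => ?_
    obtain ⟨h1, h2⟩ := mem_filter.1 hp
    obtain ⟨hs, ht⟩ := mem_product.1 h1
    rw [Fintype.mem_piFinset] at hs ht
    obtain ⟨c, hc⟩ := dvd_of_sum_invMod_eq (fun i => (mem_coprimeLT.1 (hs i)).2)
      (fun i => (mem_coprimeLT.1 (ht i)).2) h2
    have hs' : p.1 ∈ box K k n :=
      Fintype.mem_piFinset.2 fun i => coprimeLT_subset_nzLT hF n (hs i)
    have ht' : p.2 ∈ box K k n :=
      Fintype.mem_piFinset.2 fun i => coprimeLT_subset_nzLT hF n (ht i)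
    refine mem_biUnion.2 ⟨c, ?_, mem_diffPairs.2 ⟨⟨hs', ht'⟩, hc⟩⟩
    by_cases hc0 : c = 0
    · rw [hc0, mem_polysLT, degree_zero]
      exact WithBot.bot_lt_coe _
    · rw [mem_polysLT_of_ne_zero hc0]
      have h3 := hdeg _ hs' _ ht'
      rw [hc, natDegree_mul hF0 hc0] at h3
      omega
  have hterm : ∀ c ∈ polysLT K X, #(diffPairs K k n (F * c)) ≤
      2 * (Nat.card K * D ^ (2 * k + 1) * Nat.card K ^ (k * n)) := by
    intro c hc
    by_cases hc0 : c = 0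
    · rw [hc0, mul_zero]
      refine (card_diffPairs_zero_le hk hn hD).trans ?_
      calc D ^ (2 * k + 1) * Nat.card K ^ (k * n)
          = 1 * (1 * D ^ (2 * k + 1) * Nat.card K ^ (k * n)) := by ring
        _ ≤ _ := by
            gcongr
            omega
    · refine card_diffPairs_le hD (mul_ne_zero hF0 hc0) ?_
      rw [mem_polysLT_of_ne_zero hc0] at hc
      rw [natDegree_mul hF0 hc0]
      have : (2 * k - 1) * n ≤ 2 * k * n := Nat.mul_le_mul (by omega) le_rfl
      omega
  calc _ ≤ ∑ c ∈ polysLT K X, #(diffPairs K k n (F * c)) := hsub.trans card_biUnion_le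
    _ ≤ ∑ c ∈ polysLT K X, 2 * (Nat.card K * D ^ (2 * k + 1) * Nat.card K ^ (k * n)) :=
        sum_le_sum hterm
    _ = _ := by
        rw [sum_const, smul_eq_mul, card_polysLT, pow_add]
        ring

end ReciprocalEnergy

/-! ### The energy of order two via Dirichlet approximation -/

section SecondEnergy

open Finset

variable {K : Type*} [Field K] [Finite K] {m D : ℕ}

/-- Dirichlet's approximation theorem modulo `F`. -/
theorem exists_mul_mod_degree_lt {F : K[X]} (hF : F ≠ 0) (lam : K[X]) {a : ℕ}
    (ha : a ≤ F.natDegree) :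
    ∃ v : K[X], v ≠ 0 ∧ v.natDegree ≤ a ∧
      (v * lam % F).degree < ((F.natDegree - a : ℕ) : WithBot ℕ) := by
  have hX : (X ^ (F.natDegree - a) : K[X]) ≠ 0 := pow_ne_zero _ X_ne_zero
  have hcard : #(polysLT K a) < #(polysLT K (a + 1)) := by
    rw [card_polysLT, card_polysLT]
    exact Nat.pow_lt_pow_right Finite.one_lt_card (Nat.lt_succ_self a)
  -- Pigeonhole on the top `a` coefficients of the residue, which this quotient records.
  have hmaps : Set.MapsTo (fun v => v * lam % F / X ^ (F.natDegree - a))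
      (polysLT K (a + 1)) (polysLT K a) := by
    intro v _
    change v * lam % F / X ^ (F.natDegree - a) ∈ polysLT K a
    by_cases h0 : v * lam % F / X ^ (F.natDegree - a) = 0
    · rw [h0, mem_polysLT, degree_zero]
      exact WithBot.bot_lt_coe _
    · have h1 : v * lam % F ≠ 0 := by
        intro h
        rw [h] at h0
        simp at h0
      have h2 : (X ^ (F.natDegree - a) : K[X]).degree ≤ (v * lam % F).degree :=
        not_lt.1 fun h => h0 ((Polynomial.div_eq_zero_iff hX).2 h)
      have h3 := degree_add_div hX h2
      rw [degree_eq_natDegree hX, degree_eq_natDegree h0, degree_eq_natDegree h1,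
        natDegree_X_pow] at h3
      have h4 : F.natDegree - a + (v * lam % F / X ^ (F.natDegree - a)).natDegree =
        (v * lam % F).natDegree := by exact_mod_cast h3
      have h5 : (v * lam % F).natDegree < F.natDegree :=
        natDegree_lt_natDegree h1 (EuclideanDomain.mod_lt _ hF)
      rw [mem_polysLT_of_ne_zero h0]
      omega
  obtain ⟨v, hv, w, hw, hne, heq⟩ := exists_ne_map_eq_of_card_lt_of_maps_to hcard hmaps
  have hvw : v - w ≠ 0 := sub_ne_zero.2 hne
  refine ⟨v - w, hvw, ?_, ?_⟩
  · have h1 : v - w ∈ polysLT K (a + 1) := by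
      rw [mem_polysLT] at hv hw ⊢
      exact (degree_sub_le _ _).trans_lt (max_lt hv hw)
    rw [mem_polysLT_of_ne_zero hvw] at h1
    omega
  · have h1 := EuclideanDomain.div_add_mod (v * lam % F) (X ^ (F.natDegree - a))
    have h2 := EuclideanDomain.div_add_mod (w * lam % F) (X ^ (F.natDegree - a))
    rw [sub_mul, sub_mod, ← h1, ← h2, heq, add_sub_add_left_eq_sub]
    refine (degree_sub_le _ _).trans_lt (max_lt ?_ ?_)
    · simpa using degree_mod_lt (v * lam % F) hX
    · simpa using degree_mod_lt (w * lam % F) hX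

theorem eq_of_mk_eq {F x y : K[X]} {m : ℕ} (hm : m ≤ F.natDegree)
    (hx : x.degree < m) (hy : y.degree < m) (h : AdjoinRoot.mk F x = AdjoinRoot.mk F y) :
    x = y := by
  by_contra hne
  have h1 := natDegree_le_of_dvd (AdjoinRoot.mk_eq_mk.1 h) (sub_ne_zero.2 hne)
  have h2 : x - y ∈ polysLT K m := mem_polysLT.2 ((degree_sub_le _ _).trans_lt (max_lt hx hy))
  rw [mem_polysLT_of_ne_zero (sub_ne_zero.2 hne)] at h2
  omega

theorem mk_mul_mul_eq_add {K : Type*} [Field K] {F x y lam : K[X]} (hx : IsCoprime x F) (hy : IsCoprime y F)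
    (h : AdjoinRoot.mk F (invMod F x) + AdjoinRoot.mk F (invMod F y) = AdjoinRoot.mk F lam) :
    AdjoinRoot.mk F (x * y * lam) = AdjoinRoot.mk F (x + y) := by
  rw [map_mul, map_mul, map_add, ← h]
  linear_combination AdjoinRoot.mk F y * mk_mul_mk_invMod hx +
    AdjoinRoot.mk F x * mk_mul_mk_invMod hy

/-- The polynomials `x` for which `u / v` is the inverse of `x` do not contribute. -/
theorem mul_sub_ne_zero {K : Type*} [Field K] {F x y lam u v : K[X]} (hx : IsCoprime x F) (hy : IsCoprime y F)
    (h : AdjoinRoot.mk F (invMod F x) + AdjoinRoot.mk F (invMod F y) = AdjoinRoot.mk F lam)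
    (huv : AdjoinRoot.mk F u = AdjoinRoot.mk F (v * lam)) (hu : ¬ F ∣ u) : u * x - v ≠ 0 := by
  intro h0
  apply hu
  rw [← AdjoinRoot.mk_eq_zero]
  have h1 : AdjoinRoot.mk F v = AdjoinRoot.mk F u * AdjoinRoot.mk F x := by
    rw [← map_mul, sub_eq_zero.1 h0]
  rw [map_mul, h1, ← h] at huv
  have h2 := mk_mul_mk_invMod hx
  have h3 := mk_mul_mk_invMod hy
  have h4 : AdjoinRoot.mk F u * AdjoinRoot.mk F x * AdjoinRoot.mk F (invMod F y) = 0 := by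
    linear_combination (-1 : AdjoinRoot F) * huv - AdjoinRoot.mk F u * h2
  calc AdjoinRoot.mk F u = AdjoinRoot.mk F u * AdjoinRoot.mk F x *
        AdjoinRoot.mk F (invMod F y) * (AdjoinRoot.mk F (invMod F x) * AdjoinRoot.mk F y) := by
        linear_combination (-AdjoinRoot.mk F u) * h2 - AdjoinRoot.mk F u *
          (AdjoinRoot.mk F x * AdjoinRoot.mk F (invMod F x)) * h3
    _ = 0 := by rw [h4, zero_mul]

open Classical in
/-- The pairs `(x, y)` with `1 / x + 1 / y = lam` modulo `F`. -/
noncomputable def recipPairs (F : K[X]) (m : ℕ) (lam : K[X]) : Finset (K[X] × K[X]) :=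
  {p ∈ coprimeLT F m ×ˢ coprimeLT F m |
    AdjoinRoot.mk F (invMod F p.1) + AdjoinRoot.mk F (invMod F p.2) = AdjoinRoot.mk F lam}

theorem mem_recipPairs {F lam : K[X]} {p : K[X] × K[X]} :
    p ∈ recipPairs F m lam ↔ (p.1 ∈ coprimeLT F m ∧ p.2 ∈ coprimeLT F m) ∧
      AdjoinRoot.mk F (invMod F p.1) + AdjoinRoot.mk F (invMod F p.2) = AdjoinRoot.mk F lam := by
  classical
  rw [recipPairs, mem_filter, mem_product]

/-- Here u x y - v(x + y) = F t. The cutoff (m + deg F)/2 balances the degrees of the two terms and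
so bounds the number of t. For each t, (u x - v)(u y - v) = v² + u F t is nonzero, and its divisors
determine x and y. -/
theorem card_recipPairs_le {F : K[X]} (hF : 0 < F.natDegree) (hm : m ≤ F.natDegree)
    (hD : ∀ x : K[X], x ≠ 0 → x.natDegree ≤ 4 * F.natDegree → #(divs x) ≤ D)
    {lam u v : K[X]} (hu0 : u ≠ 0) (hv : v.natDegree ≤ (m + F.natDegree) / 2)
    (hu : u.natDegree < F.natDegree - (m + F.natDegree) / 2)
    (huv : AdjoinRoot.mk F u = AdjoinRoot.mk F (v * lam)) :
    #(recipPairs F m lam) ≤ D * Nat.card K ^ ((3 * m + 1 - F.natDegree) / 2) := by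
  classical
  have hF0 : F ≠ 0 := by
    rintro rfl
    simp at hF
  have hFu : ¬ F ∣ u := by
    intro h
    have := natDegree_le_of_dvd h hu0
    omega
  have hdvd : ∀ p ∈ recipPairs F m lam, F ∣ u * p.1 * p.2 - v * (p.1 + p.2) := by
    intro p hp
    obtain ⟨⟨h1, h2⟩, h3⟩ := mem_recipPairs.1 hp
    have h4 := mk_mul_mul_eq_add (mem_coprimeLT.1 h1).2 (mem_coprimeLT.1 h2).2 h3
    rw [← AdjoinRoot.mk_eq_zero]
    simp only [map_sub, map_mul, map_add] at h4 huv ⊢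
    linear_combination AdjoinRoot.mk F p.1 * AdjoinRoot.mk F p.2 * huv + AdjoinRoot.mk F v * h4
  have hdeg : ∀ p ∈ recipPairs F m lam, (u * p.1 * p.2 - v * (p.1 + p.2)).natDegree <
      F.natDegree + (3 * m + 1 - F.natDegree) / 2 ∧
        (u * p.1 * p.2 - v * (p.1 + p.2)).natDegree ≤ 3 * F.natDegree := by
    intro p hp
    obtain ⟨⟨h1, h2⟩, -⟩ := mem_recipPairs.1 hp
    have h3 := (mem_nzLT.1 (coprimeLT_subset_nzLT hF m h1)).2
    have h4 := (mem_nzLT.1 (coprimeLT_subset_nzLT hF m h2)).2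
    have h5 : (u * p.1 * p.2).natDegree ≤ u.natDegree + p.1.natDegree + p.2.natDegree :=
      natDegree_mul_le.trans (Nat.add_le_add_right natDegree_mul_le _)
    have h6 : (v * (p.1 + p.2)).natDegree ≤ v.natDegree + max p.1.natDegree p.2.natDegree :=
      natDegree_mul_le.trans (Nat.add_le_add_left (natDegree_add_le _ _) _)
    have h7 := natDegree_sub_le (u * p.1 * p.2) (v * (p.1 + p.2))
    omega
  have hmaps : ∀ p ∈ recipPairs F m lam, (u * p.1 * p.2 - v * (p.1 + p.2)) / F ∈
      polysLT K ((3 * m + 1 - F.natDegree) / 2) := by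
    intro p hp
    obtain ⟨t, ht⟩ := hdvd p hp
    rw [ht, mul_div_cancel_left₀ _ hF0]
    by_cases ht0 : t = 0
    · rw [ht0, mem_polysLT, degree_zero]
      exact WithBot.bot_lt_coe _
    · have h1 := (hdeg p hp).1
      rw [ht, natDegree_mul hF0 ht0] at h1
      rw [mem_polysLT_of_ne_zero ht0]
      omega
  rw [← card_polysLT]
  refine card_le_mul_card_image_of_maps_to hmaps _ fun t _ => ?_
  rcases eq_empty_or_nonempty {p ∈ recipPairs F m lam |
    (u * p.1 * p.2 - v * (p.1 + p.2)) / F = t} with h | ⟨p₀, hp₀⟩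
  · rw [h]
    simp
  set w := v ^ 2 + u * (F * t) with hw
  have hfac : ∀ p ∈ recipPairs F m lam, (u * p.1 * p.2 - v * (p.1 + p.2)) / F = t →
      (u * p.1 - v) * (u * p.2 - v) = w := by
    intro p hp hpt
    have h1 := hdvd p hp
    rw [← EuclideanDomain.mod_eq_zero] at h1
    have h2 := EuclideanDomain.div_add_mod (u * p.1 * p.2 - v * (p.1 + p.2)) F
    rw [hpt, h1] at h2
    rw [hw]
    linear_combination (-u) * h2
  have hne : ∀ p ∈ recipPairs F m lam, u * p.1 - v ≠ 0 ∧ u * p.2 - v ≠ 0 := by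
    intro p hp
    obtain ⟨⟨h1, h2⟩, h3⟩ := mem_recipPairs.1 hp
    have h1 := (mem_coprimeLT.1 h1).2
    have h2 := (mem_coprimeLT.1 h2).2
    exact ⟨mul_sub_ne_zero h1 h2 h3 huv hFu,
      mul_sub_ne_zero h2 h1 (by rw [add_comm]; exact h3) huv hFu⟩
  obtain ⟨hp₀, hpt₀⟩ := mem_filter.1 hp₀
  have hw0 : w ≠ 0 := by
    rw [← hfac p₀ hp₀ hpt₀]
    exact mul_ne_zero (hne p₀ hp₀).1 (hne p₀ hp₀).2
  refine le_trans ?_ (hD w hw0 ?_)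
  · refine card_le_card_of_injOn (fun p => u * p.1 - v) ?_ ?_
    · intro p hp
      obtain ⟨hp, hpt⟩ := mem_filter.1 hp
      exact mem_coe.2 ((mem_divs hw0).2 (Dvd.intro _ (hfac p hp hpt)))
    · intro p hp p' hp' heq
      obtain ⟨hp, hpt⟩ := mem_filter.1 hp
      obtain ⟨hp', hpt'⟩ := mem_filter.1 hp'
      simp only at heq
      have h1 := hfac p hp hpt
      rw [← hfac p' hp' hpt', ← heq] at h1
      have h2 := mul_left_cancel₀ (hne p hp).1 h1
      exact Prod.ext (mul_left_cancel₀ hu0 (sub_left_injective heq))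
        (mul_left_cancel₀ hu0 (sub_left_injective h2))
  · have h1 := hdvd p₀ hp₀
    rw [← EuclideanDomain.mod_eq_zero] at h1
    have h2 := EuclideanDomain.div_add_mod (u * p₀.1 * p₀.2 - v * (p₀.1 + p₀.2)) F
    rw [hpt₀, h1, add_zero] at h2
    rw [hw, h2]
    have h3 := (hdeg p₀ hp₀).2
    have h4 : (v ^ 2).natDegree ≤ 2 * v.natDegree := natDegree_pow_le
    have h5 := natDegree_mul_le (p := u) (q := u * p₀.1 * p₀.2 - v * (p₀.1 + p₀.2))
    refine (natDegree_add_le _ _).trans (max_le ?_ ?_) <;> omega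

/-- The trivial bound, needed when u = 0: x determines y modulo `F`, hence y. -/
theorem card_recipPairs_le_pow {F : K[X]} (hm : m ≤ F.natDegree) (lam : K[X]) :
    #(recipPairs F m lam) ≤ Nat.card K ^ m := by
  rw [← card_polysLT]
  refine card_le_card_of_injOn Prod.fst ?_ ?_
  · intro p hp
    exact mem_coe.2 (mem_polysLT.2 (mem_coprimeLT.1 (mem_recipPairs.1 hp).1.1).1)
  · intro p hp p' hp' heq
    obtain ⟨⟨h1, h2⟩, h3⟩ := mem_recipPairs.1 hp
    obtain ⟨⟨h1', h2'⟩, h3'⟩ := mem_recipPairs.1 hp'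
    have h4 : AdjoinRoot.mk F (invMod F p.2) = AdjoinRoot.mk F (invMod F p'.2) := by
      rw [← heq] at h3'
      exact add_left_cancel (h3.trans h3'.symm)
    have h5 := mk_mul_mk_invMod (mem_coprimeLT.1 h2).2
    have h6 := mk_mul_mk_invMod (mem_coprimeLT.1 h2').2
    have h7 : AdjoinRoot.mk F p.2 = AdjoinRoot.mk F p'.2 := by
      rw [h4] at h5
      linear_combination AdjoinRoot.mk F p'.2 * h5 - AdjoinRoot.mk F p.2 * h6
    exact Prod.ext heq (eq_of_mk_eq hm (mem_coprimeLT.1 h2).1 (mem_coprimeLT.1 h2').1 h7)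

/-- The case u = 0: `F` splits into a divisor of `v` and a divisor d of `lam`, and x y λ ≡ x + y is
read modulo d. -/
theorem exists_dvd_add_of_dvd_mul {K : Type*} [Field K] {F x y lam v : K[X]} (hF : F ≠ 0)
    (hx : IsCoprime x F) (hy : IsCoprime y F)
    (h : AdjoinRoot.mk F (invMod F x) + AdjoinRoot.mk F (invMod F y) = AdjoinRoot.mk F lam)
    (hv0 : v ≠ 0) (hv : F ∣ v * lam) :
    ∃ d, d ∣ F ∧ F.natDegree - v.natDegree ≤ d.natDegree ∧ d ∣ x + y := by
  obtain ⟨a, d, ha, hd, had⟩ := exists_dvd_and_dvd_of_dvd_mul hv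
  have ha0 := ne_zero_of_dvd_ne_zero hv0 ha
  have hd0 : d ≠ 0 := by
    rintro rfl
    exact hF (by simpa using had)
  have hdF : d ∣ F := Dvd.intro_left a had.symm
  refine ⟨d, hdF, ?_, ?_⟩
  · rw [had, natDegree_mul ha0 hd0]
    have := natDegree_le_of_dvd ha hv0
    omega
  · have h1 := hdF.trans (AdjoinRoot.mk_eq_mk.1 (mk_mul_mul_eq_add hx hy h))
    exact (dvd_sub_right (hd.mul_left _)).1 h1

open Classical in
theorem card_dvd_add_le {F : K[X]} (hF : F ≠ 0)
    (hD : ∀ x : K[X], x ≠ 0 → x.natDegree ≤ 4 * F.natDegree → #(divs x) ≤ D) (e : ℕ) :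
    #{p ∈ coprimeLT F m ×ˢ coprimeLT F m | ∃ d, d ∣ F ∧ e ≤ d.natDegree ∧ d ∣ p.1 + p.2} ≤
      D * (Nat.card K ^ m * Nat.card K ^ (m - e)) := by
  have hsub : {p ∈ coprimeLT F m ×ˢ coprimeLT F m |
      ∃ d, d ∣ F ∧ e ≤ d.natDegree ∧ d ∣ p.1 + p.2} ⊆
      ({d ∈ divs F | e ≤ d.natDegree}).biUnion fun d =>
        {p ∈ polysLT K m ×ˢ polysLT K m | d ∣ p.2 - -p.1} := by
    intro p hp
    obtain ⟨h1, d, h2, h3, h4⟩ := mem_filter.1 hp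
    obtain ⟨h5, h6⟩ := mem_product.1 h1
    refine mem_biUnion.2 ⟨d, mem_filter.2 ⟨(mem_divs hF).2 h2, h3⟩, mem_filter.2
      ⟨mem_product.2 ⟨mem_polysLT.2 (mem_coprimeLT.1 h5).1,
        mem_polysLT.2 (mem_coprimeLT.1 h6).1⟩, ?_⟩⟩
    rwa [sub_neg_eq_add, add_comm]
  refine (card_le_card hsub).trans (card_biUnion_le.trans ?_)
  calc _ ≤ ∑ d ∈ {d ∈ divs F | e ≤ d.natDegree}, Nat.card K ^ m * Nat.card K ^ (m - e) := by
        refine sum_le_sum fun d hd => ?_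
        obtain ⟨h1, h2⟩ := mem_filter.1 hd
        have hd0 := ne_zero_of_dvd_ne_zero hF ((mem_divs hF).1 h1)
        rw [card_filter, sum_product, ← card_polysLT m, ← smul_eq_mul]
        refine sum_le_card_nsmul _ _ _ fun x _ => ?_
        rw [← card_filter]
        refine (card_polysLT_congr_le m hd0 _).trans ?_
        exact Nat.pow_le_pow_right Nat.card_pos (by omega)
    _ ≤ _ := by
        rw [sum_const, smul_eq_mul]
        exact Nat.mul_le_mul_right _ ((card_filter_le _ _).trans (hD F hF (by omega)))

theorem energy_two_le_sum (F : K[X]) :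
    energy (coprimeLT F m) (fun x => AdjoinRoot.mk F (invMod F x)) 2 ≤
      ∑ p ∈ coprimeLT F m ×ˢ coprimeLT F m,
        #(recipPairs F m (invMod F p.1 + invMod F p.2)) := by
  classical
  rw [← card_sigma]
  unfold energy
  refine card_le_card_of_injOn (fun p => ⟨(p.1 0, p.1 1), (p.2 0, p.2 1)⟩) ?_ ?_
  · intro p hp
    obtain ⟨h1, h2⟩ := mem_filter.1 hp
    obtain ⟨hs, ht⟩ := mem_product.1 h1
    rw [Fintype.mem_piFinset] at hs ht
    simp only [Fin.sum_univ_two] at h2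
    refine mem_coe.2 (mem_sigma.2 ⟨mem_product.2 ⟨hs 0, hs 1⟩,
      mem_recipPairs.2 ⟨⟨ht 0, ht 1⟩, ?_⟩⟩)
    rw [map_add]
    exact h2.symm
  · intro p _ p' _ h
    simp only [Sigma.mk.injEq, heq_eq_eq, Prod.mk.injEq] at h
    refine Prod.ext (funext fun i => ?_) (funext fun i => ?_) <;> fin_cases i <;> simp [h]

/-- Pairs whose λ = 1/x + 1/y gives u = 0 number at most D q^(m+Y), because m - (deg F - a) ≤ Y;
even with the trivial bound q^m for each they match the generic contribution. -/
theorem energy_two_inv_le {F : K[X]} (hF : 0 < F.natDegree) (hm : m ≤ F.natDegree)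
    (hD : ∀ x : K[X], x ≠ 0 → x.natDegree ≤ 4 * F.natDegree → #(divs x) ≤ D) :
    energy (coprimeLT F m) (fun x => AdjoinRoot.mk F (invMod F x)) 2 ≤
      2 * D * Nat.card K ^ (2 * m + (3 * m + 1 - F.natDegree) / 2) := by
  classical
  have hF0 : F ≠ 0 := by
    rintro rfl
    simp at hF
  have hcard : #(coprimeLT F m ×ˢ coprimeLT F m) ≤ Nat.card K ^ (2 * m) := by
    rw [card_product, two_mul, pow_add, ← card_polysLT]
    have : coprimeLT F m ⊆ polysLT K m := filter_subset _ _
    gcongr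
  set a := (m + F.natDegree) / 2 with ha
  set Y := (3 * m + 1 - F.natDegree) / 2 with hY
  have hterm : ∀ p ∈ coprimeLT F m ×ˢ coprimeLT F m,
      #(recipPairs F m (invMod F p.1 + invMod F p.2)) ≤ D * Nat.card K ^ Y +
        if ∃ d, d ∣ F ∧ F.natDegree - a ≤ d.natDegree ∧ d ∣ p.1 + p.2 then Nat.card K ^ m
        else 0 := by
    intro p hp
    obtain ⟨h1, h2⟩ := mem_product.1 hp
    obtain ⟨v, hv0, hv, hu⟩ := exists_mul_mod_degree_lt hF0 (invMod F p.1 + invMod F p.2)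
      (a := a) (by omega)
    by_cases hu0 : v * (invMod F p.1 + invMod F p.2) % F = 0
    · obtain ⟨d, hd1, hd2, hd3⟩ := exists_dvd_add_of_dvd_mul hF0 (mem_coprimeLT.1 h1).2
        (mem_coprimeLT.1 h2).2 (map_add _ _ _).symm hv0 (EuclideanDomain.mod_eq_zero.1 hu0)
      rw [if_pos ⟨d, hd1, by omega, hd3⟩]
      exact (card_recipPairs_le_pow hm _).trans (Nat.le_add_left _ _)
    · refine (card_recipPairs_le hF hm hD hu0 hv
        ((natDegree_lt_iff_degree_lt hu0).2 hu) ?_).trans (Nat.le_add_right _ _)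
      rw [AdjoinRoot.mk_eq_mk]
      have := EuclideanDomain.div_add_mod (v * (invMod F p.1 + invMod F p.2)) F
      exact ⟨-(v * (invMod F p.1 + invMod F p.2) / F), by linear_combination this⟩
  calc _ ≤ _ := energy_two_le_sum F
    _ ≤ ∑ p ∈ coprimeLT F m ×ˢ coprimeLT F m, (D * Nat.card K ^ Y +
        if ∃ d, d ∣ F ∧ F.natDegree - a ≤ d.natDegree ∧ d ∣ p.1 + p.2 then Nat.card K ^ m
        else 0) := sum_le_sum hterm
    _ = #(coprimeLT F m ×ˢ coprimeLT F m) * (D * Nat.card K ^ Y) +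
        #{p ∈ coprimeLT F m ×ˢ coprimeLT F m |
          ∃ d, d ∣ F ∧ F.natDegree - a ≤ d.natDegree ∧ d ∣ p.1 + p.2} * Nat.card K ^ m := by
        rw [sum_add_distrib, sum_const, smul_eq_mul, ← sum_filter, sum_const, smul_eq_mul]
    _ ≤ Nat.card K ^ (2 * m) * (D * Nat.card K ^ Y) +
        D * (Nat.card K ^ m * Nat.card K ^ Y) * Nat.card K ^ m := by
        refine Nat.add_le_add (Nat.mul_le_mul_right _ hcard) (Nat.mul_le_mul_right _ ?_)
        refine (card_dvd_add_le hF0 hD _).trans ?_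
        refine Nat.mul_le_mul_left _ (Nat.mul_le_mul_left _ ?_)
        exact Nat.pow_le_pow_right Nat.card_pos (by omega)
    _ = _ := by ring

end SecondEnergy

/-! ### Reduction of ranges longer than deg F -/

section Periodicity

open Finset

variable {K : Type*} [Field K]

theorem isCoprime_mod {F x : K[X]} (hx : IsCoprime x F) : IsCoprime (x % F) F := by
  have h := EuclideanDomain.div_add_mod x F
  rw [← h, add_comm] at hx
  exact IsCoprime.of_add_mul_left_left hx

theorem mk_mod (F x : K[X]) : AdjoinRoot.mk F (x % F) = AdjoinRoot.mk F x := by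
  rw [AdjoinRoot.mk_eq_mk]
  have h := EuclideanDomain.div_add_mod x F
  exact ⟨-(x / F), by linear_combination h⟩

theorem mk_invMod_mod {F x : K[X]} (hx : IsCoprime x F) :
    AdjoinRoot.mk F (invMod F (x % F)) = AdjoinRoot.mk F (invMod F x) := by
  have h1 := mk_mul_mk_invMod hx
  have h2 := mk_mul_mk_invMod (isCoprime_mod hx)
  rw [mk_mod] at h2
  linear_combination AdjoinRoot.mk F (invMod F x) * h2 -
    AdjoinRoot.mk F (invMod F (x % F)) * h1

variable [Finite K]

theorem card_coprimeLT_le (F : K[X]) (n : ℕ) : #(coprimeLT F n) ≤ Nat.card K ^ n := by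
  rw [← card_polysLT]
  exact card_le_card fun x hx => mem_polysLT.2 (mem_coprimeLT.1 hx).1

/-- Inverses depend only on residues, and a class meets the range at most q^(n - deg F) times. -/
theorem energy_inv_le_of_natDegree_le {F : K[X]} (hF : F ≠ 0) (n k : ℕ) :
    energy (coprimeLT F n) (fun x => AdjoinRoot.mk F (invMod F x)) k ≤
      (Nat.card K ^ (n - F.natDegree)) ^ (2 * k) *
        energy (coprimeLT F F.natDegree) (fun x => AdjoinRoot.mk F (invMod F x)) k := by
  classical
  unfold energy
  have hcop : ∀ x ∈ coprimeLT F n, x % F ∈ coprimeLT F F.natDegree := by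
    intro x hx
    refine mem_coprimeLT.2 ⟨?_, isCoprime_mod (mem_coprimeLT.1 hx).2⟩
    rw [← degree_eq_natDegree hF]
    exact degree_mod_lt x hF
  refine card_le_mul_card_image_of_maps_to
    (f := fun p => ((fun i => p.1 i % F), fun i => p.2 i % F)) ?_ _ ?_
  · intro p hp
    obtain ⟨h1, h2⟩ := mem_filter.1 hp
    obtain ⟨hs, ht⟩ := mem_product.1 h1
    rw [Fintype.mem_piFinset] at hs ht
    refine mem_filter.2 ⟨mem_product.2 ⟨Fintype.mem_piFinset.2 fun i => hcop _ (hs i),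
      Fintype.mem_piFinset.2 fun i => hcop _ (ht i)⟩, ?_⟩
    simp only [mk_invMod_mod (mem_coprimeLT.1 (hs _)).2, mk_invMod_mod (mem_coprimeLT.1 (ht _)).2]
    exact h2
  · intro w _
    calc _ ≤ #((Fintype.piFinset fun i => {x ∈ polysLT K n | F ∣ x - w.1 i}) ×ˢ
          Fintype.piFinset fun i => {x ∈ polysLT K n | F ∣ x - w.2 i}) := by
          refine card_le_card fun p hp => ?_
          obtain ⟨h0, h2⟩ := mem_filter.1 hp
          obtain ⟨hs, ht⟩ := mem_product.1 (mem_filter.1 h0).1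
          rw [Fintype.mem_piFinset] at hs ht
          subst h2
          rw [mem_product, Fintype.mem_piFinset, Fintype.mem_piFinset]
          refine ⟨fun i => mem_filter.2 ⟨mem_polysLT.2 (mem_coprimeLT.1 (hs i)).1, ?_⟩,
            fun i => mem_filter.2 ⟨mem_polysLT.2 (mem_coprimeLT.1 (ht i)).1, ?_⟩⟩
          · exact AdjoinRoot.mk_eq_mk.1 (mk_mod F _).symm
          · exact AdjoinRoot.mk_eq_mk.1 (mk_mod F _).symm
      _ ≤ (∏ _i : Fin k, Nat.card K ^ (n - F.natDegree)) *
            ∏ _i : Fin k, Nat.card K ^ (n - F.natDegree) := by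
          rw [card_product, Fintype.card_piFinset, Fintype.card_piFinset]
          exact Nat.mul_le_mul (prod_le_prod' fun i _ => card_polysLT_congr_le n hF _)
            (prod_le_prod' fun i _ => card_polysLT_congr_le n hF _)
      _ = _ := by
          simp only [prod_const, card_univ, Fintype.card_fin]
          ring

end Periodicity

/-! ### Energy bounds as powers of q -/

section Asymptotics

open Finset

variable (K : Type*) [Field K] [Finite K]

theorem one_lt_card_real : (1 : ℝ) < Nat.card K := by
  exact_mod_cast Finite.one_lt_card

theorem exists_nat_card_divs_le {η : ℝ} (hη : 0 < η) :
    ∃ C : ℝ, 1 ≤ C ∧ ∀ N : ℕ, ∃ D : ℕ, (D : ℝ) ≤ C * (Nat.card K : ℝ) ^ (η * N) ∧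
      ∀ x : K[X], x ≠ 0 → x.natDegree ≤ N → #(divs x) ≤ D := by
  obtain ⟨C, hC, h⟩ := exists_card_divs_le K hη
  refine ⟨max C 1, le_max_right _ _, fun N =>
    ⟨⌊max C 1 * (Nat.card K : ℝ) ^ (η * N)⌋₊, Nat.floor_le (by positivity), fun x hx hN => ?_⟩⟩
  refine Nat.le_floor ((h x hx).trans ?_)
  gcongr
  · exact le_max_left _ _
  · exact (one_lt_card_real K).le

/-- The bound for the second energy, valid above the exponent `1 / 4`. -/
theorem exists_energy_two_le {κ η : ℝ} (hκ : κ ≤ 1 / 16) (hη : 0 < η) :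
    ∃ C : ℝ, 1 ≤ C ∧ ∀ (F : K[X]) (m : ℕ), 0 < F.natDegree →
      (F.natDegree : ℝ) * (1 / 4 + κ) ≤ m →
      (energy (coprimeLT F m) (fun x => AdjoinRoot.mk F (invMod F x)) 2 : ℝ) ≤
        C * (Nat.card K : ℝ) ^
          (4 * (m : ℝ) - F.natDegree / 2 - 2 * κ * F.natDegree + η * F.natDegree) := by
  obtain ⟨C, hC, h⟩ := exists_nat_card_divs_le K (η := η / 4) (by positivity)
  have hq := one_lt_card_real K
  have hq0 : (0 : ℝ) < Nat.card K := by linarith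
  refine ⟨2 * C * Nat.card K, by nlinarith, fun F m hF hm => ?_⟩
  have hF0 : F ≠ 0 := by
    rintro rfl
    simp at hF
  have hr : (0 : ℝ) < F.natDegree := by exact_mod_cast hF
  have main : ∀ m : ℕ, m ≤ F.natDegree → (F.natDegree : ℝ) * (1 / 4 + κ) ≤ m →
      (energy (coprimeLT F m) (fun x => AdjoinRoot.mk F (invMod F x)) 2 : ℝ) ≤
        2 * C * Nat.card K * (Nat.card K : ℝ) ^
          (4 * (m : ℝ) - F.natDegree / 2 - 2 * κ * F.natDegree + η * F.natDegree) := by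
    intro m hmr hm
    obtain ⟨D, hD, hdivs⟩ := h (4 * F.natDegree)
    have h1 := energy_two_inv_le hF hmr hdivs
    -- If the truncated term vanishes, 2m suffices because m ≥ r(1/4 + κ). Otherwise the exponent is
    -- about 7m/2 - r/2, and κ ≤ 1/16 gives m/2 ≥ 2κr.
    have hexp : ((2 * m + (3 * m + 1 - F.natDegree) / 2 : ℕ) : ℝ) ≤
        1 + (4 * (m : ℝ) - F.natDegree / 2 - 2 * κ * F.natDegree) := by
      rcases le_total (3 * m + 1) F.natDegree with h2 | h2
      · rw [Nat.sub_eq_zero_of_le h2]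
        push_cast
        linarith
      · have h3 : 2 * (2 * m + (3 * m + 1 - F.natDegree) / 2) + F.natDegree ≤ 7 * m + 1 := by
          omega
        have h4 : 2 * ((2 * m + (3 * m + 1 - F.natDegree) / 2 : ℕ) : ℝ) + F.natDegree ≤
            7 * m + 1 := by exact_mod_cast h3
        nlinarith
    calc _ ≤ ((2 * D * Nat.card K ^ (2 * m + (3 * m + 1 - F.natDegree) / 2) : ℕ) : ℝ) := by
          exact_mod_cast h1
      _ = 2 * D * (Nat.card K : ℝ) ^ ((2 * m + (3 * m + 1 - F.natDegree) / 2 : ℕ) : ℝ) := by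
          rw [Real.rpow_natCast]
          push_cast
          ring
      _ ≤ 2 * (C * (Nat.card K : ℝ) ^ (η / 4 * (4 * F.natDegree : ℕ))) * (Nat.card K : ℝ) ^
            (1 + (4 * (m : ℝ) - F.natDegree / 2 - 2 * κ * F.natDegree)) := by
          gcongr
          exact hq.le
      _ = 2 * C * ((Nat.card K : ℝ) ^ (1 : ℝ) * (Nat.card K : ℝ) ^
            (4 * (m : ℝ) - F.natDegree / 2 - 2 * κ * F.natDegree + η * F.natDegree)) := by
          rw [← Real.rpow_add hq0, mul_assoc 2, mul_assoc C, ← Real.rpow_add hq0, ← mul_assoc]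
          congr 2
          push_cast
          ring
      _ = _ := by
          rw [Real.rpow_one]
          ring
  rcases le_total m F.natDegree with hmr | hmr
  · exact main m hmr hm
  have h1 := energy_inv_le_of_natDegree_le hF0 m 2
  have h2 := main F.natDegree le_rfl (by nlinarith)
  calc _ ≤ (((Nat.card K ^ (m - F.natDegree)) ^ (2 * 2) *
        energy (coprimeLT F F.natDegree) (fun x => AdjoinRoot.mk F (invMod F x)) 2 : ℕ) : ℝ) := by
        exact_mod_cast h1
    _ = (Nat.card K : ℝ) ^ (((m : ℝ) - F.natDegree) * 4) *
          energy (coprimeLT F F.natDegree) (fun x => AdjoinRoot.mk F (invMod F x)) 2 := by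
        rw [Real.rpow_mul hq0.le, ← Nat.cast_sub hmr, Real.rpow_natCast]
        norm_cast
    _ ≤ (Nat.card K : ℝ) ^ (((m : ℝ) - F.natDegree) * 4) * _ :=
        mul_le_mul_of_nonneg_left h2 (by positivity)
    _ = _ := by
        rw [mul_left_comm, ← Real.rpow_add hq0]
        congr 2
        ring

theorem exists_energy_le_of_le {η : ℝ} (hη : 0 < η) (L : ℕ) :
    ∃ C : ℝ, 1 ≤ C ∧ ∀ (F : K[X]) (n k : ℕ), 0 < F.natDegree → 1 ≤ n → n ≤ F.natDegree →
      1 ≤ k → k ≤ L → (F.natDegree : ℝ) / 2 ≤ k * n → ((k : ℝ) - 1) * n ≤ F.natDegree / 2 →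
      (energy (coprimeLT F n) (fun x => AdjoinRoot.mk F (invMod F x)) k : ℝ) ≤
        C * (Nat.card K : ℝ) ^ (2 * (k * n : ℝ) - F.natDegree / 2 + η * F.natDegree) := by
  -- The 3 absorbs 2kn ≤ 3 deg F, the 2L + 1 absorbs the power `D ^ (2 * k + 1)`.
  obtain ⟨C, hC, h⟩ := exists_nat_card_divs_le K (η := η / (3 * (2 * L + 1))) (by positivity)
  have hq := one_lt_card_real K
  have hq0 : (0 : ℝ) < Nat.card K := by linarith
  have hC1 : 1 ≤ C ^ (2 * L + 1) := one_le_pow₀ hC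
  refine ⟨2 * Nat.card K * C ^ (2 * L + 1), by nlinarith, ?_⟩
  intro F n k hF hn hnr hk hkL h1 h2
  obtain ⟨D, hD, hdivs⟩ := h (3 * F.natDegree)
  have hkn : 2 * k * n ≤ 3 * F.natDegree := by
    have h3 : (n : ℝ) ≤ F.natDegree := by exact_mod_cast hnr
    have h4 : ((2 * k * n : ℕ) : ℝ) ≤ (3 * F.natDegree : ℕ) := by
      push_cast
      linarith
    exact_mod_cast h4
  have h3 := energy_inv_le hF hk hn fun x hx hx' => hdivs x hx (hx'.trans hkn)
  have hexp : ((k * n + ((2 * k - 1) * n - F.natDegree) : ℕ) : ℝ) ≤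
      2 * (k * n : ℝ) - F.natDegree / 2 := by
    rcases le_total ((2 * k - 1) * n) F.natDegree with h4 | h4
    · rw [Nat.sub_eq_zero_of_le h4]
      push_cast
      linarith
    · rw [Nat.cast_add, Nat.cast_sub h4, Nat.cast_mul, Nat.cast_mul, Nat.cast_sub (by omega)]
      push_cast
      linarith
  have hDpow : (D : ℝ) ^ (2 * k + 1) ≤
      C ^ (2 * L + 1) * (Nat.card K : ℝ) ^ (η * F.natDegree) := by
    have h5 : (1 : ℝ) ≤ C * (Nat.card K : ℝ) ^
        (η / (3 * (2 * L + 1)) * (3 * F.natDegree : ℕ)) :=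
      one_le_mul_of_one_le_of_one_le hC (Real.one_le_rpow hq.le (by positivity))
    calc (D : ℝ) ^ (2 * k + 1) ≤ _ := pow_le_pow_left₀ (Nat.cast_nonneg _) hD _
      _ ≤ _ := pow_le_pow_right₀ h5 (show 2 * k + 1 ≤ 2 * L + 1 by omega)
      _ = _ := by
        rw [mul_pow, ← Real.rpow_mul_natCast hq0.le]
        congr 2
        push_cast
        field_simp
  calc _ ≤ ((2 * Nat.card K * D ^ (2 * k + 1) *
        Nat.card K ^ (k * n + ((2 * k - 1) * n - F.natDegree)) : ℕ) : ℝ) := by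
        exact_mod_cast h3
    _ = 2 * Nat.card K * (D : ℝ) ^ (2 * k + 1) *
        (Nat.card K : ℝ) ^ ((k * n + ((2 * k - 1) * n - F.natDegree) : ℕ) : ℝ) := by
        rw [Real.rpow_natCast]
        push_cast
        ring
    _ ≤ 2 * Nat.card K * (C ^ (2 * L + 1) * (Nat.card K : ℝ) ^ (η * F.natDegree)) *
        (Nat.card K : ℝ) ^ (2 * (k * n : ℝ) - F.natDegree / 2) := by
        gcongr
        exact hq.le
    _ = _ := by
        rw [Real.rpow_add hq0]
        ring

/-- For n ≤ r, k = ⌈r/(2n)⌉ has kn ≥ r/2 and (k-1)n ≤ r/2. The first gives kn ≤ 2kn - r/2, the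
second (3k-1)n - r ≤ 2kn - r/2. That k is bounded in terms of ε keeps `C` uniform. -/
theorem exists_energy_le {ε η : ℝ} (hε : 0 < ε) (hη : 0 < η) :
    ∃ C : ℝ, 1 ≤ C ∧ ∀ (F : K[X]) (n : ℕ), 0 < F.natDegree → 1 ≤ n →
      (F.natDegree : ℝ) * ε ≤ n → ∃ k : ℕ, 1 ≤ k ∧ k ≤ ⌈1 / (2 * ε)⌉₊ + 1 ∧
      (energy (coprimeLT F n) (fun x => AdjoinRoot.mk F (invMod F x)) k : ℝ) ≤
        C * (Nat.card K : ℝ) ^ (2 * (k * n : ℝ) - F.natDegree / 2 + η * F.natDegree) := by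
  obtain ⟨C, hC, h⟩ := exists_energy_le_of_le K hη (⌈1 / (2 * ε)⌉₊ + 1)
  have hq0 : (0 : ℝ) < Nat.card K := by linarith [one_lt_card_real K]
  refine ⟨C, hC, fun F n hF hn hεn => ?_⟩
  have hF0 : F ≠ 0 := by
    rintro rfl
    simp at hF
  have hr : (0 : ℝ) < F.natDegree := by exact_mod_cast hF
  have hn0 : (0 : ℝ) < n := by exact_mod_cast hn
  rcases le_total n F.natDegree with hnr | hnr
  · have hpos : 0 < (F.natDegree : ℝ) / (2 * n) := by positivity
    have h1 := Nat.le_ceil ((F.natDegree : ℝ) / (2 * n))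
    have h2 := Nat.ceil_lt_add_one hpos.le
    have hk : 1 ≤ ⌈(F.natDegree : ℝ) / (2 * n)⌉₊ := Nat.ceil_pos.2 hpos
    have hkL : ⌈(F.natDegree : ℝ) / (2 * n)⌉₊ ≤ ⌈1 / (2 * ε)⌉₊ + 1 := by
      refine (Nat.ceil_le_ceil ?_).trans (Nat.le_succ _)
      rw [div_le_div_iff₀ (by positivity) (by positivity)]
      linarith
    refine ⟨_, hk, hkL, h F n _ hF hn hnr hk hkL ?_ ?_⟩
    · rw [div_le_iff₀ (by positivity)] at h1
      linarith
    · rw [← sub_lt_iff_lt_add, lt_div_iff₀ (by positivity)] at h2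
      linarith
  · refine ⟨1, le_rfl, Nat.le_add_left _ _, ?_⟩
    have h1 := energy_inv_le_of_natDegree_le hF0 n 1
    have h2 := h F F.natDegree 1 hF hF le_rfl le_rfl (Nat.le_add_left _ _)
      (by push_cast; linarith) (by push_cast; linarith)
    calc _ ≤ (((Nat.card K ^ (n - F.natDegree)) ^ (2 * 1) *
          energy (coprimeLT F F.natDegree) (fun x => AdjoinRoot.mk F (invMod F x)) 1 : ℕ) : ℝ) := by
          exact_mod_cast h1
      _ = (Nat.card K : ℝ) ^ (((n : ℝ) - F.natDegree) * 2) *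
            energy (coprimeLT F F.natDegree) (fun x => AdjoinRoot.mk F (invMod F x)) 1 := by
          rw [Real.rpow_mul hq0.le, ← Nat.cast_sub hnr, Real.rpow_natCast]
          norm_cast
      _ ≤ (Nat.card K : ℝ) ^ (((n : ℝ) - F.natDegree) * 2) * _ :=
          mul_le_mul_of_nonneg_left h2 (by positivity)
      _ = _ := by
          rw [mul_left_comm, ← Real.rpow_add hq0]
          congr 2
          push_cast
          ring

end Asymptotics

/-! ### Assembling the estimate -/

section Main

open Finset

variable {K : Type*} [Field K] [Finite K]

theorem bilinearSum_eq {F : K[X]} (hF : F ≠ 0) (a : K[X]) (m n : ℕ) (α β : K[X] → ℂ) :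
    bilinearSum F a m n α β = ∑ x ∈ coprimeLT F m, ∑ y ∈ coprimeLT F n, α x * β y *
      quotChar hF (AdjoinRoot.mk F a * AdjoinRoot.mk F (invMod F x) *
        AdjoinRoot.mk F (invMod F y)) := by
  refine sum_congr rfl fun x hx => sum_congr rfl fun y hy => ?_
  rw [← quotChar_mk hF, map_mul, mk_invMod_mul (mem_coprimeLT.1 hx).2 (mem_coprimeLT.1 hy).2,
    mul_assoc (AdjoinRoot.mk F a)]

theorem norm_bilinearSum_pow_le {F a : K[X]} (hF : F ≠ 0) (ha : IsCoprime a F) {m n k : ℕ}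
    (hk : 1 ≤ k) {α β : K[X] → ℂ} (hα : ∀ x : K[X], x.degree < m → ‖α x‖ ≤ 1)
    (hβ : ∀ x : K[X], x.degree < n → ‖β x‖ ≤ 1) :
    ‖bilinearSum F a m n α β‖ ^ (4 * k) ≤
      ((Nat.card K : ℝ) ^ m) ^ (4 * (k - 1)) * (((Nat.card K : ℝ) ^ n) ^ (2 * k) *
        (energy (coprimeLT F n) (fun x => AdjoinRoot.mk F (invMod F x)) k *
        ((Nat.card K : ℝ) ^ F.natDegree *
          energy (coprimeLT F m) (fun x => AdjoinRoot.mk F (invMod F x)) 2))) := by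
  have := finite_adjoinRoot hF
  have := Fintype.ofFinite (AdjoinRoot F)
  obtain ⟨l, rfl⟩ : ∃ l, k = l + 1 := ⟨k - 1, by omega⟩
  have hunit : IsUnit (AdjoinRoot.mk F a) := IsUnit.of_mul_eq_one _ (mk_mul_mk_invMod ha)
  have h := norm_bilinear_pow_le (quotChar_isPrimitive hF) (coprimeLT F m) (coprimeLT F n)
    (fun x => AdjoinRoot.mk F a * AdjoinRoot.mk F (invMod F x))
    (fun x => AdjoinRoot.mk F (invMod F x)) α β
    (fun x hx => hα x (mem_coprimeLT.1 hx).1) (fun x hx => hβ x (mem_coprimeLT.1 hx).1) l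
  rw [← bilinearSum_eq hF, energy_mul_left _ _ _ hunit, ← Nat.card_eq_fintype_card,
    natCard_adjoinRoot hF] at h
  refine h.trans ?_
  have h1 : (#(coprimeLT F m) : ℝ) ≤ (Nat.card K : ℝ) ^ m := by
    exact_mod_cast card_coprimeLT_le F m
  have h2 : (#(coprimeLT F n) : ℝ) ≤ (Nat.card K : ℝ) ^ n := by
    exact_mod_cast card_coprimeLT_le F n
  push_cast
  gcongr

theorem norm_eMod (F x : K[X]) : ‖eMod F x‖ = 1 := by
  rw [eMod, eInfty_eq_stdAddChar]
  exact AddChar.norm_apply _ _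

theorem norm_bilinearSum_le (F a : K[X]) {m n : ℕ} {α β : K[X] → ℂ}
    (hα : ∀ x : K[X], x.degree < m → ‖α x‖ ≤ 1) (hβ : ∀ x : K[X], x.degree < n → ‖β x‖ ≤ 1) :
    ‖bilinearSum F a m n α β‖ ≤ (Nat.card K : ℝ) ^ ((m : ℝ) + n) := by
  have hq0 : (0 : ℝ) < Nat.card K := by linarith [one_lt_card_real K]
  have h1 : (#(coprimeLT F m) : ℝ) ≤ (Nat.card K : ℝ) ^ m := by
    exact_mod_cast card_coprimeLT_le F m
  have h2 : (#(coprimeLT F n) : ℝ) ≤ (Nat.card K : ℝ) ^ n := by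
    exact_mod_cast card_coprimeLT_le F n
  calc _ ≤ ∑ x ∈ coprimeLT F m, ∑ y ∈ coprimeLT F n, (1 : ℝ) := by
        refine (norm_sum_le _ _).trans (sum_le_sum fun x hx => ?_)
        refine (norm_sum_le _ _).trans (sum_le_sum fun y hy => ?_)
        rw [norm_mul, norm_mul, norm_eMod, mul_one]
        exact mul_le_one₀ (hα x (mem_coprimeLT.1 hx).1) (norm_nonneg _)
          (hβ y (mem_coprimeLT.1 hy).1)
    _ = #(coprimeLT F m) * #(coprimeLT F n) := by simp
    _ ≤ (Nat.card K : ℝ) ^ m * (Nat.card K : ℝ) ^ n := by gcongr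
    _ = _ := by rw [Real.rpow_add hq0, Real.rpow_natCast, Real.rpow_natCast]

/-- The two energies save r/2 each, which cancels the q^r from Parseval, and E_2 saves a further
2κr. Divisor losses of κr/2 in each energy leave κr before the 4k-th root. -/
theorem exists_norm_bilinearSum_le_of_norm_le_one (K : Type*) [Field K] [Finite K]
    {ε κ : ℝ} (hε : 0 < ε) (hκ0 : 0 < κ) (hκ : κ ≤ 1 / 16) (hκε : κ ≤ ε) :
    ∃ C : ℝ, 1 ≤ C ∧ ∀ (m n : ℕ) (F a : K[X]) (α β : K[X] → ℂ), F ≠ 0 → IsCoprime a F → 0 < n →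
      (F.natDegree : ℝ) * ε ≤ n → (F.natDegree : ℝ) * (1 / 4 + ε) ≤ m →
      (∀ x : K[X], x.degree < m → ‖α x‖ ≤ 1) → (∀ x : K[X], x.degree < n → ‖β x‖ ≤ 1) →
      ‖bilinearSum F a m n α β‖ ≤ C * (Nat.card K : ℝ) ^
        ((m : ℝ) + n - F.natDegree * (κ / (4 * (⌈1 / (2 * ε)⌉₊ + 1 : ℕ)))) := by
  obtain ⟨C₁, hC₁, h₁⟩ := exists_energy_two_le K hκ (half_pos hκ0)
  obtain ⟨C₂, hC₂, h₂⟩ := exists_energy_le K hε (half_pos hκ0)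
  have hq := one_lt_card_real K
  have hq0 : (0 : ℝ) < Nat.card K := by linarith
  set L := ⌈1 / (2 * ε)⌉₊ + 1 with hL
  have hC12 : 1 ≤ C₁ * C₂ := one_le_mul_of_one_le_of_one_le hC₁ hC₂
  refine ⟨C₁ * C₂, hC12, fun m n F a α β hF ha hn hrn hrm hα hβ => ?_⟩
  rcases Nat.eq_zero_or_pos F.natDegree with hr | hr
  · rw [hr, Nat.cast_zero, zero_mul, sub_zero]
    exact (norm_bilinearSum_le F a hα hβ).trans (le_mul_of_one_le_left (by positivity) hC12)
  have hr0 : (0 : ℝ) < F.natDegree := by exact_mod_cast hr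
  obtain ⟨k, hk, hkL, hE⟩ := h₂ F n hr hn hrn
  have hE2 := h₁ F m hr (by nlinarith)
  have hk0 : (0 : ℝ) < k := by exact_mod_cast hk
  have hmain : ‖bilinearSum F a m n α β‖ ^ (4 * k) ≤
      (C₁ * C₂ * (Nat.card K : ℝ) ^ ((m : ℝ) + n - F.natDegree * (κ / (4 * k)))) ^ (4 * k) := by
    refine (norm_bilinearSum_pow_le hF ha hk hα hβ).trans ?_
    calc _ ≤ ((Nat.card K : ℝ) ^ m) ^ (4 * (k - 1)) * (((Nat.card K : ℝ) ^ n) ^ (2 * k) *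
          ((C₂ * (Nat.card K : ℝ) ^ (2 * (k * n : ℝ) - F.natDegree / 2 + κ / 2 * F.natDegree)) *
          ((Nat.card K : ℝ) ^ F.natDegree * (C₁ * (Nat.card K : ℝ) ^
            (4 * (m : ℝ) - F.natDegree / 2 - 2 * κ * F.natDegree + κ / 2 * F.natDegree))))) := by
          gcongr
      _ = C₁ * C₂ * (Nat.card K : ℝ) ^ (4 * (k : ℝ) * (m + n) - F.natDegree * κ) := by
          simp only [← pow_mul]
          simp only [← Real.rpow_natCast]
          rw [show ∀ a b c d e : ℝ, a * (b * (C₂ * c * (d * (C₁ * e)))) =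
            C₁ * C₂ * (a * (b * (c * (d * e)))) by intros; ring]
          simp only [← Real.rpow_add hq0]
          congr 2
          push_cast [Nat.cast_sub hk]
          ring
      _ ≤ (C₁ * C₂) ^ (4 * k) *
            (Nat.card K : ℝ) ^ (4 * (k : ℝ) * (m + n) - F.natDegree * κ) := by
          gcongr
          exact le_self_pow₀ hC12 (by omega)
      _ = _ := by
          rw [mul_pow (C₁ * C₂), ← Real.rpow_mul_natCast hq0.le]
          congr 2
          push_cast
          field_simp
  refine (le_of_pow_le_pow_left₀ (by omega) (by positivity) hmain).trans ?_
  gcongr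
  exact hq.le

theorem exists_le_mul_add_of_isLittleO {φ : ℕ → ℝ}
    (hφ : φ =o[Filter.atTop] fun r : ℕ => (r : ℝ)) {c : ℝ} (hc : 0 < c) :
    ∃ M : ℝ, ∀ r, φ r ≤ c * r + M := by
  obtain ⟨N, hN⟩ := Filter.eventually_atTop.1 (hφ.def hc)
  refine ⟨∑ i ∈ range N, |φ i|, fun r => ?_⟩
  have hM : 0 ≤ ∑ i ∈ range N, |φ i| := sum_nonneg fun _ _ => abs_nonneg _
  rcases le_or_gt N r with h | h
  · have h1 := hN r h
    rw [Real.norm_eq_abs, Real.norm_of_nonneg (Nat.cast_nonneg _)] at h1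
    linarith [le_abs_self (φ r)]
  · have h1 := single_le_sum (f := fun i => |φ i|) (fun _ _ => abs_nonneg _) (mem_range.2 h)
    have h2 : 0 ≤ c * r := by positivity
    linarith [le_abs_self (φ r)]

theorem bilinearSum_smul (F a : K[X]) (m n : ℕ) (α β : K[X] → ℂ) (c : ℂ) :
    bilinearSum F a m n (fun x => c * α x) (fun x => c * β x) =
      c ^ 2 * bilinearSum F a m n α β := by
  simp only [bilinearSum, mul_sum]
  refine sum_congr rfl fun x _ => sum_congr rfl fun y _ => ?_
  ring

end Main

end FqKloosterman

theorem theorem2p1 (ε : ℝ) (hε : 0 < ε) :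
    ∃ δ : ℝ, 0 < δ ∧
      ∀ (K : Type*) [Field K] [Fintype K], Odd (Fintype.card K) →
      ∀ φ : ℕ → ℝ, (φ =o[Filter.atTop] fun r : ℕ => (r : ℝ)) →
      ∃ C : ℝ, 0 < C ∧
        ∀ (r m n : ℕ) (F a : Polynomial K) (α β : Polynomial K → ℂ),
          F.degree = (r : WithBot ℕ) → IsCoprime a F →
          0 < n → 0 < m →
          (r : ℝ) * ε ≤ (n : ℝ) → (r : ℝ) * (1 / 4 + ε) ≤ (m : ℝ) →
          (∀ x : Polynomial K, x.degree < (m : WithBot ℕ) →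
            ‖α x‖ ≤ (Fintype.card K : ℝ) ^ φ r) →
          (∀ x : Polynomial K, x.degree < (n : WithBot ℕ) →
            ‖β x‖ ≤ (Fintype.card K : ℝ) ^ φ r) →
          ‖FqKloosterman.bilinearSum F a m n α β‖ ≤
            C * (Fintype.card K : ℝ) ^ ((m : ℝ) + (n : ℝ) - (r : ℝ) * δ) := by
  obtain ⟨κ, hκ0, hκ, hκε⟩ : ∃ κ : ℝ, 0 < κ ∧ κ ≤ 1 / 16 ∧ κ ≤ ε :=
    ⟨min (1 / 16) ε, by positivity, min_le_left _ _, min_le_right _ _⟩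
  set δ := κ / (4 * (⌈1 / (2 * ε)⌉₊ + 1 : ℕ)) with hδ
  have hδ0 : 0 < δ := by positivity
  -- Normalising both weights costs q^(2φ(r)) ≤ q^(δr/2 + 2M), paid for by half of the saving.
  refine ⟨δ / 2, half_pos hδ0, fun K _ _ _ φ hφ => ?_⟩
  obtain ⟨C, hC, h⟩ :=
    FqKloosterman.exists_norm_bilinearSum_le_of_norm_le_one K hε hκ0 hκ hκε
  obtain ⟨M, hM⟩ := FqKloosterman.exists_le_mul_add_of_isLittleO hφ (c := δ / 4) (by positivity)
  rw [Nat.card_eq_fintype_card] at h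
  have hq : (1 : ℝ) < Fintype.card K := by exact_mod_cast Fintype.one_lt_card
  set q : ℝ := (Fintype.card K : ℝ)
  have hq0 : 0 < q := by linarith
  refine ⟨C * q ^ (2 * M), by positivity, ?_⟩
  intro r m n F a α β hF ha hn _ hrn hrm hα hβ
  have hF0 : F ≠ 0 := by
    rintro rfl
    simp at hF
  have hFr : F.natDegree = r := natDegree_eq_of_degree_eq_some hF
  have hc0 : ((q ^ φ r : ℝ) : ℂ) ≠ 0 := by
    exact_mod_cast (Real.rpow_pos_of_pos hq0 _).ne'
  have hnorm : ∀ z : ℂ, ‖z‖ ≤ q ^ φ r → ‖((q ^ φ r : ℝ) : ℂ)⁻¹ * z‖ ≤ 1 := by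
    intro z hz
    rw [norm_mul, norm_inv, Complex.norm_real, Real.norm_of_nonneg (by positivity),
      inv_mul_le_iff₀ (by positivity), mul_one]
    exact hz
  have h1 := h m n F a (fun x => ((q ^ φ r : ℝ) : ℂ)⁻¹ * α x)
    (fun x => ((q ^ φ r : ℝ) : ℂ)⁻¹ * β x) hF0 ha hn (by rwa [hFr]) (by rwa [hFr])
    (fun x hx => hnorm _ (hα x hx)) (fun x hx => hnorm _ (hβ x hx))
  rw [FqKloosterman.bilinearSum_smul, norm_mul, norm_pow, norm_inv, Complex.norm_real,
    Real.norm_of_nonneg (by positivity), inv_pow, inv_mul_le_iff₀ (by positivity), hFr] at h1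
  refine h1.trans ?_
  calc (q ^ φ r) ^ 2 * (C * q ^ ((m : ℝ) + n - r * δ))
      ≤ (q ^ (δ / 4 * r + M)) ^ 2 * (C * q ^ ((m : ℝ) + n - r * δ)) := by
        gcongr
        · exact hq.le
        · exact hM r
    _ = C * (q ^ (2 * (δ / 4 * r + M)) * q ^ ((m : ℝ) + n - r * δ)) := by
        rw [← Real.rpow_mul_natCast hq0.le, Nat.cast_ofNat, mul_comm (_ + _) (2 : ℝ)]
        ring
    _ = C * (q ^ (2 * M) * q ^ ((m : ℝ) + n - r * (δ / 2))) := by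
        rw [← Real.rpow_add hq0, ← Real.rpow_add hq0]
        congr 2
        ring
    _ = _ := by ring
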